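/- Let $(E,\mathcal L)$ be a complex of oriented matroids (COM): $E$ is a finite set and $\emptyset\ne\mathcal L\subseteq\{0,+,-\}^E$ is such that * (face symmetry) $X\circ(-Y)\in\mathcal L$ for all $X,Y\in\mathcal L$; * (strong elimination) for all $X,Y\in\mathcal L$ and all $e\in S(X,Y)$ there is $V\in\mathcal L$ with $V_e=0$ and $V_f=(X\circ Y)_f$ for all $f\in E\setminus S(X,Y)$. Here $(X\circ Y)_e=X_e$ if $X_e\neq0$ and $(X\circ Y)_e=Y_e$ otherwise, and $S(X,Y)=\{e: X_e=-Y_e\ne0\}$. Let $z(X)=\{e: X_e=0\}$ and let $Z$ be the poset $\{z(X):X\in\mathcal L\}$ ordered by inclusion, with minimum $\hat 0$; an atom is an element that covers $\hat0$. Let $w_e$ $(e\in E)$ be indeterminates over $\mathbb Z$, and for $x\in Z$ put $$w(x)=\sum_{e\in x,\ e\text{ not a loop}}w_e ,$$ where $e$ is a loop if $X_e=0$ for all $X\in\mathcal L$. (If there are no loops, then $w(z(Y))=\sum_{e\in z(Y)}w_e$.) Fix any labeling $l$ that assigns to every $x\in Z\setminus\{\hat0\}$ an atom $l(x)\le x$.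 A chain $C=[x_1\lessdot x_2\lessdot\dots\lessdot x_k]$ in $Z$, with $\hat0=x_0\lessdot x_1$ and $x_k$ maximal in $Z$, is neat if $l(x_i)\not\le x_{i-1}$ for $1\le i\le k$ (if $Z=\{\hat 0\}$, the only such chain is the empty one, $k=0$). Its size is $|C|=k$. A tuple of atoms $(a_1,\dots,a_k)$ generates $C$, written $ch(a_1,\dots,a_k)=C$, if $x_i=a_1\vee\dots\vee a_i$ for all $i\le k$. The chain matrix $\mathfrak C$ of $Z$ has rows and columns indexed by the neat chains, and its entries are $$\mathfrak C_{C,C'}=\sum \operatorname{sgn}(\sigma)\,w(a_1)\cdots w(a_k),\qquad k=|C|,$$ where the sum is over all $k$-tuples of atoms $(a_1,\dots,a_k)$ and all permutations $\sigma$ of $\{1,\dots,k\}$ with $ch(a_1,\dots,a_k)=C$ and $ch(a_{\sigma(1)},\dots,a_{\sigma(k)})=C'$ (so the entry is $0$ if $|C|\neq|C'|$). Let $\mu$ be the Möbius function of $Z$, let $r(x)$ be the rank of $x$ (the length of a longest chain from $\hat0$ to $x$), and let $$\beta(x)=(-1)^{r(x)}\sum_{y\le x}\mu(\hat0,y)\,r(y),\qquad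 \rho(x)=\beta(x)\sum_{m\ge x,\ m\text{ maximal in }Z}|\mu(x,m)| .$$ Then $\rho(x)\ge0$ for all $x\in Z$, and $$\det\mathfrak C=\pm\prod_{x\in Z}w(x)^{\rho(x)},$$ where the product has one factor for each zero set $x=z(Y)$, $Y\in\mathcal L$, with the convention $0^0=1$. -/

import Mathlib

noncomputable section

open scoped Classical in
/-- The Möbius function of a finite poset (Mathlib's, from the incidence algebra):
`μ(x,x) = 1`, `μ(x,y) = -∑_{x ≤ z < y} μ(x,z)` for `x < y`, and `μ(x,y) = 0` if `x ≰ y`. -/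
def posetMoebius {P : Type*} [PartialOrder P] [Fintype P] (x y : P) : ℤ :=
  letI : LocallyFiniteOrder P := Fintype.toLocallyFiniteOrder
  IncidenceAlgebra.mu ℤ x y

/-- The rank `r(x)`: the length of a longest chain of elements that ends in `x`
(in a graded poset: the length of every unrefinable chain from the bottom to `x`). -/
def posetRank {P : Type*} [PartialOrder P] (x : P) : ℕ :=
  (Order.height x).toNat

open scoped Classical in
/-- Crapo's beta function `β(x) = (-1)^{r(x)} ∑_{y ≤ x} μ(0̂,y) r(y)`. -/
def posetBeta {P : Type*} [PartialOrder P] [OrderBot P] [Fintype P] (x : P) : ℤ :=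
  (-1) ^ posetRank x *
    ∑ y ∈ Finset.univ.filter (fun y : P => y ≤ x), posetMoebius ⊥ y * (posetRank y : ℤ)

open scoped Classical in
/-- The cumulated rho function `ρ(x) = β(x) ∑ |μ(x,m)|`, summed over the maximal
elements `m ≥ x`. -/
def cumulatedRho {P : Type*} [PartialOrder P] [OrderBot P] [Fintype P] (x : P) : ℤ :=
  posetBeta x *
    ∑ m ∈ Finset.univ.filter (fun m : P => IsMax m ∧ x ≤ m), |posetMoebius x m|

/-- A labeling of the elements other than `0̂` by atoms: `l(x)` is an atom with `l(x) ≤ x`.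
The value at `0̂` plays no role. -/
def IsAtomLabeling {P : Type*} [PartialOrder P] [OrderBot P] (l : P → P) : Prop :=
  ∀ x, x ≠ ⊥ → IsAtom (l x) ∧ l x ≤ x

/-- Sequences `x₀ ⋖ x₁ ⋖ ⋯ ⋖ x_k`. -/
abbrev CoverSeries (P : Type*) [PartialOrder P] : Type _ :=
  RelSeries {(a, b) : P × P | a ⋖ b}

/-- The neat maximal chains for the labeling `l`. A maximal chain `[x₁ ⋖ ⋯ ⋖ x_k]` is stored
together with `x₀ = 0̂` in front (so `k` is `length`); it ends in a maximal element, and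
neatness is `l(x_i) ≰ x_{i-1}` for `1 ≤ i ≤ k`. -/
def NeatChain {P : Type*} [PartialOrder P] [OrderBot P] (l : P → P) : Type _ :=
  {C : CoverSeries P // C.head = ⊥ ∧ IsMax C.last ∧
    ∀ i : Fin C.length, ¬ l (C i.succ) ≤ C i.castSucc}

theorem coverSeries_finite (P : Type*) [PartialOrder P] [Finite P] : Finite (CoverSeries P) := by
  classical
  have := Fintype.ofFinite P
  refine Finite.of_injective
    (fun C : CoverSeries P => (⟨C.length, C.toFun, fun i => (C.step i).lt⟩ : LTSeries P)) ?_
  rintro ⟨n, f, hf⟩ ⟨m, g, hg⟩ h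
  simp only [RelSeries.mk.injEq] at h
  obtain ⟨rfl, h⟩ := h
  obtain rfl := eq_of_heq h
  rfl

instance NeatChain.instFintype {P : Type*} [PartialOrder P] [OrderBot P] [Fintype P]
    (l : P → P) : Fintype (NeatChain l) :=
  haveI := coverSeries_finite P
  haveI : Finite (NeatChain l) := inferInstanceAs (Finite (Subtype _))
  Fintype.ofFinite _

instance NeatChain.instDecidableEq {P : Type*} [PartialOrder P] [OrderBot P]
    (l : P → P) : DecidableEq (NeatChain l) :=
  Classical.decEq _

/-- `ch(a₁,…,a_k) = [x₁ ⋖ ⋯ ⋖ x_k]`: the `a_i` are atoms, the number of atoms is the size of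
the chain, and `x_i = a₁ ∨ ⋯ ∨ a_i` for all `i` (with `Fin k` indexed from `0`). -/
def Generates {P : Type*} [PartialOrder P] [OrderBot P] {k : ℕ} (a : Fin k → P)
    (C : CoverSeries P) : Prop :=
  (∀ i, IsAtom (a i)) ∧
    ∃ h : C.length = k, ∀ i : Fin C.length, IsLUB (a '' {j | j ≤ i.cast h}) (C i.succ)

open scoped Classical in
/-- The chain matrix, with the weight `w a` assigned to the atom `a` (only the values of `w` on
atoms are used). The entry at `(C, C')` is the sum of `sgn(σ) w(a₁)⋯w(a_k)` over the tuples of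
atoms and the permutations `σ` with `ch(a₁,…,a_k) = C` and `ch(a_{σ(1)},…,a_{σ(k)}) = C'`. -/
def chainMatrix {P : Type*} [PartialOrder P] [OrderBot P] [Fintype P] {R : Type*} [CommRing R]
    (l : P → P) (w : P → R) : Matrix (NeatChain l) (NeatChain l) R :=
  fun C C' => ∑ a : Fin C.1.length → P, ∑ σ : Equiv.Perm (Fin C.1.length),
    if Generates a C.1 ∧ Generates (a ∘ σ) C'.1 then
      ((Equiv.Perm.sign σ : ℤ) : R) * ∏ i, w (a i)
    else 0

/-- The composition of sign vectors. -/
def signComp {E : Type*} (X Y : E → SignType) : E → SignType :=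
  fun e => if X e ≠ 0 then X e else Y e

/-- The separator of two sign vectors. -/
def signSeparator {E : Type*} (X Y : E → SignType) : Set E :=
  {e | X e = -Y e ∧ X e ≠ 0}

/-- The zero set of a sign vector. -/
def signZeroSet {E : Type*} [Fintype E] (X : E → SignType) : Finset E :=
  Finset.univ.filter (fun e => X e = 0)

/-- Complexes of oriented matroids on the ground set `E`: nonempty systems of sign vectors
with face symmetry and strong elimination. -/
structure COM (E : Type*) where
  /-- The set of covectors. -/
  covectors : Set (E → SignType)
  nonempty : covectors.Nonempty
  face_symm : ∀ X ∈ covectors, ∀ Y ∈ covectors, signComp X (-Y) ∈ covectors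
  strong_elim : ∀ X ∈ covectors, ∀ Y ∈ covectors, ∀ e ∈ signSeparator X Y,
    ∃ Z ∈ covectors, Z e = 0 ∧ ∀ f, f ∉ signSeparator X Y → Z f = signComp X Y f

namespace COM

/-- The poset `{z(X) : X covector}`, ordered by inclusion. -/
def ZeroSetPoset {E : Type*} [Fintype E] (M : COM E) : Type _ :=
  {S : Finset E // ∃ X ∈ M.covectors, signZeroSet X = S}

instance {E : Type*} [Fintype E] (M : COM E) : PartialOrder M.ZeroSetPoset :=
  inferInstanceAs (PartialOrder {S : Finset E // ∃ X ∈ M.covectors, signZeroSet X = S})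

instance {E : Type*} [Fintype E] (M : COM E) : Fintype M.ZeroSetPoset :=
  haveI : Finite M.ZeroSetPoset :=
    inferInstanceAs (Finite {S : Finset E // ∃ X ∈ M.covectors, signZeroSet X = S})
  Fintype.ofFinite _

theorem comp_mem {E : Type*} (M : COM E) {X Y : E → SignType} (hX : X ∈ M.covectors)
    (hY : Y ∈ M.covectors) : signComp X Y ∈ M.covectors := by
  have h := M.face_symm X hX _ (M.face_symm X hX Y hY)
  have e : signComp X (-(signComp X (-Y))) = signComp X Y := by
    funext i
    by_cases hi : X i = 0 <;> simp [signComp, hi]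
  rwa [e] at h

theorem exists_least {E : Type*} [Fintype E] (M : COM E) :
    ∃ b : M.ZeroSetPoset, ∀ x, b ≤ x := by
  classical
  obtain ⟨X₀, h₀⟩ := M.nonempty
  have : Nonempty M.ZeroSetPoset := ⟨⟨_, X₀, h₀, rfl⟩⟩
  obtain ⟨b, hb⟩ := (Set.toFinite (Set.univ : Set M.ZeroSetPoset)).exists_minimal Set.univ_nonempty
  refine ⟨b, ?_⟩
  obtain ⟨S, X, hX, rfl⟩ := b
  rintro ⟨T, Y, hY, rfl⟩
  let c : M.ZeroSetPoset := ⟨signZeroSet (signComp X Y), _, M.comp_mem hX hY, rfl⟩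
  have hc : ∀ e, e ∈ signZeroSet (signComp X Y) ↔ X e = 0 ∧ Y e = 0 := by
    intro e
    by_cases h : X e = 0 <;> simp [signZeroSet, signComp, h]
  have hle : c ≤ ⟨signZeroSet X, X, hX, rfl⟩ := by
    intro e he
    simpa [signZeroSet] using ((hc e).1 he).1
  have hge := hb.2 trivial hle
  intro e he
  simpa [signZeroSet] using ((hc e).1 (hge he)).2

instance {E : Type*} [Fintype E] (M : COM E) : OrderBot M.ZeroSetPoset where
  bot := M.exists_least.choose
  bot_le := M.exists_least.choose_spec

/-- A loop is an element of the ground set on which every covector vanishes. -/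
def IsLoop {E : Type*} (M : COM E) (e : E) : Prop :=
  ∀ X ∈ M.covectors, X e = 0

open scoped Classical in
/-- The weight of a zero set: the sum of the indeterminates `w_e` over its elements `e` that are
not loops (so over all its elements if there are no loops). -/
def weight {E : Type*} [Fintype E] (M : COM E) (x : M.ZeroSetPoset) : MvPolynomial E ℤ :=
  ∑ e ∈ x.1.filter (fun e => ¬ M.IsLoop e), MvPolynomial.X e

end COM

end

/-!
The poset `Z` of zero sets of a COM is locally geometric: every principal ideal is a geometric
lattice (`LocallyGeometric`). The exchange property behind this, `COM.exists_exchange`, is strong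
elimination. The weight of a zero set is the sum of the weights of the atoms below it, so the
theorem is a statement about locally geometric posets with arbitrary weights on the atoms,
`det_chainMatrix`.

In the exterior algebra on the atoms put `e(x) = ∑_{a ≤ x} a` and attach to a saturated chain
`x₁ ⋖ ⋯ ⋖ x_k` the product of the `e(x_i)`. Expanding it gives the signed sum of the atom tuples
that generate the chain, and hence the entry of the chain matrix at `(C, C')` is the Gram entry
`det (w(x_i ∧ x'_j))` (`tupleGram_eq_sum_perm`). The matrix is block diagonal with one block for
each maximal element, so it suffices to evaluate the Gram determinant `D_y` of the neat chains
that end in a given `y`; it turns out to be `∏_{x ≤ y} w(x)^{β(x)|μ(x,y)|}`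
(`neatDet_eq_prod_pow`).

Filling a gap in a chain in all possible ways gives a linear relation. These relations straighten
every product of `e`'s along a chain into an integral combination of neat chains
(`flagVec_mem_span_neat`), and the label tuples of the neat chains are a dual basis
(`atomCoeff_label`). So, for an atom `a ≤ y`, the Gram determinant `N_{k+1}` of all neat chains of
length `k + 1` below `y` can be computed in the family consisting of the neat chains `T_{k+1}`
whose top avoids `a` and the products of `e(y)` with the chains in `T_k`. Laplace expansion along
`y` makes the Gram matrix of this family block triangular, whence
`N_{k+1} w(y)^{|T_{k+1}|} = t_{k+1} t_k` with `t_k` the Gram determinant of `e(y) T_k`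
(`neatDet_mul_pow`). Since `N_k` is the product of `D_x` over the `x ≤ y` of rank `k`, the
alternating product over `k` telescopes to `∏_{x ≤ y} D_x^{(-1)^{r(x)}} = w(y)^{(-1)^{r(y)} β(y)}`
(`prod_neatDet_below`), where the exponent comes from Weisner's theorem. Möbius inversion and the
alternation of the signs of `μ` give the formula for `D_y`, over the field of rational functions
in the atom weights. There `D_y` is a polynomial; as `w(y)` can be made to vanish without any
`w(x)`, `⊥ < x < y`, vanishing, `β(y)` is nonnegative (`posetBeta_nonneg`).
-/

section LocallyGeometric

open Finset
open scoped Classical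

theorem posetRank_bot {P : Type*} [PartialOrder P] [OrderBot P] : posetRank (⊥ : P) = 0 := by
  simp [posetRank]

theorem posetBeta_bot {P : Type*} [PartialOrder P] [OrderBot P] [Fintype P] :
    posetBeta (⊥ : P) = 0 := by
  rw [posetBeta]
  refine mul_eq_zero_of_right _ (Finset.sum_eq_zero fun y hy => ?_)
  simp only [mem_filter, mem_univ, true_and, le_bot_iff] at hy
  simp [hy, posetRank_bot]

/-! ### Rank and Möbius function of a finite poset -/

section FinitePoset

variable {P : Type*} [PartialOrder P] [Fintype P]

theorem height_ne_top (x : P) : Order.height x ≠ ⊤ := by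
  intro h
  obtain ⟨p, -, hp⟩ := Order.exists_series_of_le_height x (n := Fintype.card P) (by simp [h])
  have := Fintype.card_le_of_injective p p.strictMono.injective
  simp [hp] at this

theorem coe_posetRank (x : P) : ((posetRank x : ℕ) : ℕ∞) = Order.height x :=
  ENat.natCast_toNat (height_ne_top x)

theorem posetRank_lt {x y : P} (h : x < y) : posetRank x < posetRank y := by
  have := Order.height_strictMono h (lt_top_iff_ne_top.2 (height_ne_top x))
  rw [← coe_posetRank, ← coe_posetRank] at this
  exact_mod_cast this

theorem posetRank_le {y : P} {n : ℕ} (h : ∀ z, z ⋖ y → posetRank z < n) : posetRank y ≤ n := by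
  have : Order.height y ≤ n := by
    rw [Order.height_le_coe_iff]
    intro z hz
    obtain ⟨c, hzc, hc⟩ := exists_le_covBy_of_lt hz
    refine lt_of_le_of_lt (Order.height_mono hzc) ?_
    rw [← coe_posetRank]
    exact_mod_cast h c hc
  rw [← coe_posetRank] at this
  exact_mod_cast this

theorem posetMoebius_self (x : P) : posetMoebius x x = 1 := by
  simp [posetMoebius]

theorem posetMoebius_of_not_le {x y : P} (h : ¬ x ≤ y) : posetMoebius x y = 0 := by
  let _ : LocallyFiniteOrder P := Fintype.toLocallyFiniteOrder
  exact IncidenceAlgebra.apply_eq_zero_of_not_le h _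

theorem sum_posetMoebius_right {x y : P} (h : x ≠ y) :
    ∑ z ∈ univ.filter (fun z => z ≤ y), posetMoebius x z = 0 := by
  let _ : LocallyFiniteOrder P := Fintype.toLocallyFiniteOrder
  have := IncidenceAlgebra.sum_Icc_mu_right (𝕜 := ℤ) x y
  rw [if_neg h] at this
  rw [← this]
  symm
  refine Finset.sum_subset (fun z hz => by simpa using (Finset.mem_Icc.1 hz).2) ?_
  intro z hz hz'
  refine posetMoebius_of_not_le fun hxz => hz' ?_
  simpa using ⟨hxz, by simpa using hz⟩

theorem sum_posetMoebius_left {x y : P} (h : x ≠ y) :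
    ∑ z ∈ univ.filter (fun z => x ≤ z ∧ z ≤ y), posetMoebius z y = 0 := by
  let _ : LocallyFiniteOrder P := Fintype.toLocallyFiniteOrder
  have := IncidenceAlgebra.sum_Icc_mu_left (𝕜 := ℤ) x y
  rw [if_neg h] at this
  rw [← this]
  refine Finset.sum_congr (by ext z; simp) fun _ _ => rfl

end FinitePoset

/-! ### Locally geometric posets -/

/-- A bounded-below poset all of whose principal ideals are geometric lattices, described without
reference to joins: meets exist, adjoining an atom to an element below a common upper bound is
possible and produces a cover, and comparable elements are separated by atoms. -/
class LocallyGeometric (P : Type*) [PartialOrder P] [OrderBot P] : Prop where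
  exists_meet : ∀ x y : P, ∃ m, m ≤ x ∧ m ≤ y ∧ ∀ t, t ≤ x → t ≤ y → t ≤ m
  exists_cover : ∀ x a z : P, IsAtom a → ¬ a ≤ x → x ≤ z → a ≤ z →
    ∃ s, x ⋖ s ∧ a ≤ s ∧ ∀ t, x ≤ t → a ≤ t → s ≤ t
  exists_atom : ∀ x y : P, x < y → ∃ a, IsAtom a ∧ a ≤ y ∧ ¬ a ≤ x

namespace LocallyGeometric

variable {P : Type*} [PartialOrder P] [OrderBot P] [LocallyGeometric P]

theorem le_of_covBy {x s t a : P} (ha : IsAtom a) (hx : ¬ a ≤ x) (hs : x ⋖ s) (has : a ≤ s)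
    (hxt : x ≤ t) (hat : a ≤ t) : s ≤ t := by
  obtain ⟨s', h1, h2, h3⟩ := exists_cover x a s ha hx hs.le has
  rcases hs.eq_or_eq h1.le (h3 s hs.le has) with h | h
  · exact absurd h h1.lt.ne'
  · exact h ▸ h3 t hxt hat

theorem eq_of_covBy {x s t a : P} (ha : IsAtom a) (hx : ¬ a ≤ x) (hs : x ⋖ s) (has : a ≤ s)
    (ht : x ⋖ t) (hat : a ≤ t) : s = t :=
  le_antisymm (le_of_covBy ha hx hs has ht.le hat) (le_of_covBy ha hx ht hat hs.le has)

/-- Two elements covering `x` below a common upper bound `s` that covers one of them are both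
covered by `s`. -/
theorem covBy_of_diamond {x x' t s : P} (h1 : x ⋖ x') (h2 : x' ⋖ s) (h3 : x ⋖ t) (h4 : t ≤ s)
    (hne : t ≠ x') : t ⋖ s := by
  obtain ⟨a, ha, hax', hax⟩ := exists_atom x x' h1.lt
  have hat : ¬ a ≤ t := fun h => hne (eq_of_covBy ha hax h3 h h1 hax')
  obtain ⟨v, hv1, hv2, hv3⟩ := exists_cover t a s ha hat h4 (hax'.trans h2.le)
  have hvs : v ≤ s := hv3 s h4 (hax'.trans h2.le)
  have hx'v : x' ≤ v := le_of_covBy ha hax h1 hax' (h3.le.trans hv1.le) hv2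
  rcases h2.eq_or_eq hx'v hvs with h | h
  · exact absurd ((h1.eq_or_eq h3.le (h ▸ hv1.le)).resolve_left h3.lt.ne') hne
  · exact h ▸ hv1

section Finite

variable [Fintype P]

/-- Coatoms of a principal ideal have the same rank, provided the poset is known to be graded
strictly below. The proof moves from `z` to `z'` through coatoms that meet `z'` in ever larger
elements. -/
theorem posetRank_eq_of_covBy_covBy {y : P}
    (ih : ∀ v, v < y → ∀ u, u ⋖ v → posetRank v = posetRank u + 1) {z' : P} (hz' : z' ⋖ y) :
    ∀ c z : P, z ⋖ y → c ≤ z → c ≤ z' → (∀ t, t ≤ z → t ≤ z' → t ≤ c) →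
      posetRank z = posetRank z' := by
  intro c
  induction c using WellFoundedGT.induction with
  | ind c IH =>
  intro z hz hcz hcz' hc
  by_cases hzz : z = z'
  · rw [hzz]
  have hnle : ¬ z' ≤ z := fun h => hzz ((hz'.eq_or_eq h hz.le).resolve_right hz.lt.ne)
  have hnle' : ¬ z ≤ z' := fun h => hzz ((hz.eq_or_eq h hz'.le).resolve_right hz'.lt.ne).symm
  have hclt : c < z := lt_of_le_of_ne hcz (fun h => hnle' (h ▸ hcz'))
  obtain ⟨u, hcu, huz⟩ := exists_le_covBy_of_lt hclt
  obtain ⟨b, hb, hbz', hbc⟩ := exists_atom c z' (lt_of_le_of_ne hcz' fun h => hnle (h ▸ hcz))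
  have hbz : ¬ b ≤ z := fun h => hbc (hc b h hbz')
  have hbu : ¬ b ≤ u := fun h => hbz (h.trans huz.le)
  obtain ⟨v, hv1, hv2, hv3⟩ := exists_cover u b y hb hbu (huz.le.trans hz.le) (hbz'.trans hz'.le)
  have hvy : v ≤ y := hv3 y (huz.le.trans hz.le) (hbz'.trans hz'.le)
  have hvz : v ⋖ y := covBy_of_diamond huz hz hv1 hvy (fun h => hbz (h ▸ hv2))
  rw [ih z hz.lt u huz, ← ih v hvz.lt u hv1]
  obtain ⟨m, hm1, hm2, hm3⟩ := exists_meet v z'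
  have hcm : c < m := lt_of_le_of_ne (hm3 c (hcu.trans hv1.le) hcz')
    (fun h => hbc (h ▸ hm3 b hv2 hbz'))
  exact IH m hcm v hvz hm1 hm2 hm3

theorem posetRank_covBy {x y : P} (h : x ⋖ y) : posetRank y = posetRank x + 1 := by
  induction y using WellFoundedLT.induction generalizing x with
  | ind y IH =>
  refine le_antisymm (posetRank_le fun z hz => ?_) (posetRank_lt h.lt)
  obtain ⟨c, h1, h2, h3⟩ := exists_meet z x
  have := posetRank_eq_of_covBy_covBy (fun v hv u hu => IH v hv hu) h c z hz h1 h2 h3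
  omega

/-- Every element `h ≤ y` not above the atom `a ≤ y` is covered by exactly one element `v ≥ a`,
and `v ≤ y`. -/
theorem sum_sum_covBy {M : Type*} [AddCommMonoid M] {a y : P} (ha : IsAtom a) (hay : a ≤ y)
    (f : P → M) :
    ∑ v ∈ univ.filter (fun v => v ≤ y ∧ a ≤ v), ∑ h ∈ univ.filter (fun h => h ⋖ v ∧ ¬ a ≤ h), f h
      = ∑ h ∈ univ.filter (fun h => h ≤ y ∧ ¬ a ≤ h), f h := by
  rw [Finset.sum_comm' (s' := fun h => univ.filter (fun v => (v ≤ y ∧ a ≤ v) ∧ h ⋖ v))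
    (t' := univ.filter (fun h => h ≤ y ∧ ¬ a ≤ h))]
  · refine Finset.sum_congr rfl fun h hh => ?_
    simp only [mem_filter, mem_univ, true_and] at hh
    obtain ⟨s, h1, h2, h3⟩ := exists_cover h a y ha hh.2 hh.1 hay
    rw [Finset.sum_const, Finset.card_eq_one.2 ⟨s, ?_⟩, one_smul]
    ext v
    simp only [mem_filter, mem_univ, true_and, mem_singleton]
    constructor
    · rintro ⟨⟨_, hv⟩, hc⟩
      exact eq_of_covBy ha hh.2 hc hv h1 h2
    · rintro rfl
      exact ⟨⟨h3 y hh.1 hay, h2⟩, h1⟩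
  · intro v h
    simp only [mem_filter, mem_univ, true_and]
    constructor
    · rintro ⟨⟨h1, h2⟩, h3, h4⟩
      exact ⟨⟨⟨h1, h2⟩, h3⟩, h3.le.trans h1, h4⟩
    · rintro ⟨⟨⟨h1, h2⟩, h3⟩, _, h4⟩
      exact ⟨⟨h1, h2⟩, h3, h4⟩

/-- Weisner's theorem. -/
theorem posetMoebius_eq_neg_sum {x a : P} (ha : IsAtom a) (hax : ¬ a ≤ x) (y : P) (hay : a ≤ y) :
    posetMoebius x y = -∑ h ∈ univ.filter (fun h => h ⋖ y ∧ ¬ a ≤ h), posetMoebius x h := by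
  induction y using WellFoundedLT.induction with
  | ind y IH =>
  have h0 := sum_posetMoebius_right (x := x) (y := y) (fun h => hax (h ▸ hay))
  rw [← Finset.sum_filter_add_sum_filter_not _ (fun z => a ≤ z), filter_filter, filter_filter,
    ← sum_sum_covBy ha hay, ← Finset.sum_add_distrib, Finset.sum_eq_single y] at h0
  · linarith
  · intro v hv hvy
    simp only [mem_filter, mem_univ, true_and] at hv
    rw [IH v (lt_of_le_of_ne hv.1 hvy) hv.2]
    ring
  · simp [hay]

/-- Rota's sign theorem. -/
theorem posetMoebius_sign_nonneg (x y : P) (hxy : x ≤ y) :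
    0 ≤ (-1) ^ (posetRank x + posetRank y) * posetMoebius x y := by
  induction y using WellFoundedLT.induction with
  | ind y IH =>
  rcases eq_or_lt_of_le hxy with rfl | hlt
  · rw [posetMoebius_self, ← two_mul, pow_mul]; simp
  obtain ⟨a, ha, hay, hax⟩ := exists_atom x y hlt
  rw [posetMoebius_eq_neg_sum ha hax y hay, ← Finset.sum_neg_distrib, Finset.mul_sum]
  refine Finset.sum_nonneg fun h hh => ?_
  simp only [mem_filter, mem_univ, true_and] at hh
  by_cases hxh : x ≤ h
  · have := IH h hh.1.lt hxh
    have e : (-1 : ℤ) ^ (posetRank x + posetRank y) * -posetMoebius x h =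
        (-1) ^ (posetRank x + posetRank h) * posetMoebius x h := by
      rw [posetRank_covBy hh.1, ← add_assoc, pow_succ]
      ring
    rwa [e]
  · simp [posetMoebius_of_not_le hxh]

theorem abs_posetMoebius {x y : P} (hxy : x ≤ y) :
    |posetMoebius x y| = (-1) ^ (posetRank x + posetRank y) * posetMoebius x y := by
  rw [← abs_of_nonneg (posetMoebius_sign_nonneg x y hxy), abs_mul, abs_pow]
  simp

/-- Crapo's beta function through the elements that avoid a fixed atom. -/
theorem posetBeta_eq_neg_sum {a y : P} (ha : IsAtom a) (hay : a ≤ y) :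
    (-1) ^ posetRank y * posetBeta y =
      -∑ x ∈ univ.filter (fun x => x ≤ y ∧ ¬ a ≤ x), posetMoebius ⊥ x := by
  have hab : ¬ a ≤ ⊥ := fun h => ha.1 (le_bot_iff.1 h)
  rw [posetBeta, ← mul_assoc, ← mul_pow]
  simp only [mul_neg, mul_one, neg_neg, one_pow, one_mul]
  rw [← Finset.sum_filter_add_sum_filter_not _ (fun z => a ≤ z), filter_filter, filter_filter]
  have key : ∑ v ∈ univ.filter (fun v => v ≤ y ∧ a ≤ v), posetMoebius ⊥ v * (posetRank v : ℤ) =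
      ∑ v ∈ univ.filter (fun v => v ≤ y ∧ a ≤ v), ∑ h ∈ univ.filter (fun h => h ⋖ v ∧ ¬ a ≤ h),
        -(posetMoebius ⊥ h * ((posetRank h : ℤ) + 1)) := by
    refine Finset.sum_congr rfl fun v hv => ?_
    simp only [mem_filter, mem_univ, true_and] at hv
    rw [posetMoebius_eq_neg_sum ha hab v hv.2, neg_mul, Finset.sum_mul, ← Finset.sum_neg_distrib]
    refine Finset.sum_congr rfl fun h hh => ?_
    simp only [mem_filter, mem_univ, true_and] at hh
    rw [posetRank_covBy hh.1]
    push_cast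
    ring
  rw [key, sum_sum_covBy ha hay, ← Finset.sum_add_distrib, ← Finset.sum_neg_distrib]
  exact Finset.sum_congr rfl fun h _ => by ring

end Finite

end LocallyGeometric

/-! ### Neat chains as descending tuples -/

section Tuples

variable {P : Type*} [PartialOrder P] [OrderBot P]

/-- The first (largest) entry of a descending tuple, `⊥` for the empty tuple. -/
def tupleTop : {k : ℕ} → (Fin k → P) → P
  | 0, _ => ⊥
  | _ + 1, u => u 0

/-- Neat saturated chains `u 0 ⋗ u 1 ⋗ ⋯ ⋗ u (k - 1) ⋗ ⊥` for the labeling `l`, listed in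
descending order and without `⊥`. They need not end in a maximal element. -/
def IsNeat (l : P → P) : {k : ℕ} → (Fin k → P) → Prop
  | 0, _ => True
  | _ + 1, u => IsNeat l (Fin.tail u) ∧ tupleTop (Fin.tail u) ⋖ u 0 ∧
      ¬ l (u 0) ≤ tupleTop (Fin.tail u)

@[simp]
theorem tupleTop_zero (u : Fin 0 → P) : tupleTop u = ⊥ := rfl

@[simp]
theorem tupleTop_succ {k : ℕ} (u : Fin (k + 1) → P) : tupleTop u = u 0 := rfl

theorem isNeat_zero (l : P → P) (u : Fin 0 → P) : IsNeat l u := trivial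

theorem isNeat_cons {l : P → P} {k : ℕ} {x : P} {u : Fin k → P} :
    IsNeat l (Fin.cons x u : Fin (k + 1) → P) ↔
      IsNeat l u ∧ tupleTop u ⋖ x ∧ ¬ l x ≤ tupleTop u := by
  simp [IsNeat]

theorem IsNeat.le_top {l : P → P} {k : ℕ} {u : Fin k → P} (h : IsNeat l u) (p : Fin k) :
    u p ≤ tupleTop u := by
  induction k with
  | zero => exact p.elim0
  | succ k ih =>
    refine Fin.cases le_rfl (fun q => ?_) p
    exact (ih h.1 q).trans h.2.1.le

theorem IsNeat.antitone {l : P → P} {k : ℕ} {u : Fin k → P} (h : IsNeat l u) : Antitone u := by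
  induction k with
  | zero => exact fun i => i.elim0
  | succ k ih =>
    intro i j hij
    induction i using Fin.cases with
    | zero => exact h.le_top j
    | succ i =>
      induction j using Fin.cases with
      | zero => exact absurd hij (by simp)
      | succ j => exact ih h.1 (Fin.succ_le_succ_iff.1 hij)

theorem IsNeat.posetRank_top [LocallyGeometric P] [Fintype P] {l : P → P} {k : ℕ} {u : Fin k → P}
    (h : IsNeat l u) : posetRank (tupleTop u) = k := by
  induction k with
  | zero => exact posetRank_bot
  | succ k ih => rw [tupleTop_succ, LocallyGeometric.posetRank_covBy h.2.1, ih h.1]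

theorem IsNeat.ne_bot {l : P → P} {k : ℕ} {u : Fin k → P} (h : IsNeat l u) (p : Fin k) :
    u p ≠ ⊥ := by
  induction k with
  | zero => exact p.elim0
  | succ k ih =>
    refine Fin.cases ?_ (fun q => ?_) p
    · exact ((bot_le).trans_lt h.2.1.lt).ne'
    · exact ih h.1 q

end Tuples

/-! ### Flag vectors in the exterior algebra -/

section FlagVectors

variable {P : Type*} [PartialOrder P] [OrderBot P]

variable (P) in
/-- The type of atoms. -/
abbrev Atoms : Type _ := {a : P // IsAtom a}

/-- The indicator function of the atoms below `x`. -/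
noncomputable def atomVec (x : P) : Atoms P → ℤ := fun a => if a.1 ≤ x then 1 else 0

/-- The degree-one element `∑ a`, over the atoms `a ≤ x`, of the exterior algebra on the atoms. -/
noncomputable def atomSum (x : P) :
    ExteriorAlgebra ℤ (Atoms P → ℤ) := ExteriorAlgebra.ι ℤ (atomVec x)

/-- The element `e(u₀) ∧ ⋯ ∧ e(u_{k-1})` of the exterior algebra, where `e(x)` is the sum of the
atoms below `x`. For a saturated chain this is, up to the order of the factors, the signed sum of
all atom tuples that generate the chain. -/
noncomputable def flagVec {k : ℕ} (u : Fin k → P) : ExteriorAlgebra ℤ (Atoms P → ℤ) :=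
  ExteriorAlgebra.ιMulti ℤ k (fun i => atomVec (u i))

theorem flagVec_succ {k : ℕ} (u : Fin (k + 1) → P) :
    flagVec u = atomSum (u 0) * flagVec (Fin.tail u) :=
  ExteriorAlgebra.ιMulti_succ_apply _

theorem flagVec_cons {k : ℕ} (x : P) (u : Fin k → P) :
    flagVec (Fin.cons x u : Fin (k + 1) → P) = atomSum x * flagVec u := by
  rw [flagVec_succ]; simp

theorem atomSum_mul_self (x : P) : atomSum x * atomSum x = 0 := ExteriorAlgebra.ι_sq_zero _

theorem atomSum_mul_cancel (x : P) (v : ExteriorAlgebra ℤ (Atoms P → ℤ)) :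
    atomSum x * (atomSum x * v) = 0 := by
  rw [← mul_assoc, atomSum_mul_self, zero_mul]

theorem atomSum_bot : atomSum (⊥ : P) = 0 := by
  have : atomVec (⊥ : P) = 0 := by
    funext a
    exact if_neg fun h => a.2.1 (le_bot_iff.1 h)
  rw [atomSum, this, map_zero]

theorem atomSum_top_mul_flagVec {k : ℕ} (u : Fin k → P) :
    atomSum (tupleTop u) * flagVec u = 0 := by
  cases k with
  | zero => simp [atomSum_bot]
  | succ k => rw [flagVec_succ, tupleTop_succ, atomSum_mul_cancel]

/-- The flag vectors of the neat chains of length `k` whose top satisfies `Q`. -/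
def neatFamily (l : P → P) (k : ℕ) (Q : P → Prop) : Set (ExteriorAlgebra ℤ (Atoms P → ℤ)) :=
  {v | ∃ u : Fin k → P, IsNeat l u ∧ Q (tupleTop u) ∧ v = flagVec u}

theorem neatFamily_mono (l : P → P) (k : ℕ) {Q Q' : P → Prop} (h : ∀ x, Q x → Q' x) :
    neatFamily l k Q ⊆ neatFamily l k Q' := by
  rintro _ ⟨u, hu, hq, rfl⟩
  exact ⟨u, hu, h _ hq, rfl⟩

/-- The elements below `y` that are not above `a`. -/
abbrev AvoidsBelow (a y x : P) : Prop := x ≤ y ∧ ¬ a ≤ x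

/-- The vectors `e(y) ∧ v`, for `v` in a family. -/
def atomSumImage (y : P) (S : Set (ExteriorAlgebra ℤ (Atoms P → ℤ))) :
    Set (ExteriorAlgebra ℤ (Atoms P → ℤ)) :=
  (fun v => atomSum y * v) '' S

theorem atomSum_mul_mem_span {s : Set (ExteriorAlgebra ℤ (Atoms P → ℤ))}
    {t : Set (ExteriorAlgebra ℤ (Atoms P → ℤ))} {x : P}
    (h : ∀ v ∈ s, atomSum x * v ∈ Submodule.span ℤ t) {v : ExteriorAlgebra ℤ (Atoms P → ℤ)}
    (hv : v ∈ Submodule.span ℤ s) : atomSum x * v ∈ Submodule.span ℤ t := by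
  induction hv using Submodule.span_induction with
  | mem v hv => exact h v hv
  | zero => simp
  | add v w _ _ hv hw => rw [mul_add]; exact add_mem hv hw
  | smul c v _ hv => rw [mul_smul_comm]; exact Submodule.smul_mem _ _ hv

variable [LocallyGeometric P] [Fintype P]

open LocallyGeometric

theorem atomSum_sub {x z : P} (hxz : x ≤ z) :
    atomSum z - atomSum x =
      ∑ s ∈ univ.filter (fun s => x ⋖ s ∧ s ≤ z), (atomSum s - atomSum x) := by
  have : atomVec z - atomVec x =
      ∑ s ∈ univ.filter (fun s => x ⋖ s ∧ s ≤ z), (atomVec s - atomVec x) := by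
    funext a
    simp only [Pi.sub_apply, Finset.sum_apply]
    by_cases hax : a.1 ≤ x
    · rw [Finset.sum_eq_zero]
      · simp [atomVec, hax, hax.trans hxz]
      · intro s hs
        simp only [mem_filter, mem_univ, true_and] at hs
        simp [atomVec, hax, hax.trans hs.1.le]
    by_cases haz : a.1 ≤ z
    · obtain ⟨s, h1, h2, h3⟩ := exists_cover x a.1 z a.2 hax hxz haz
      rw [Finset.sum_eq_single s]
      · simp [atomVec, hax, haz, h2]
      · intro t ht hts
        simp only [mem_filter, mem_univ, true_and] at ht
        have : ¬ a.1 ≤ t := fun h => hts (eq_of_covBy a.2 hax ht.1 h h1 h2)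
        simp [atomVec, hax, this]
      · intro h
        exact absurd (by simpa using ⟨h1, h3 z hxz haz⟩) h
    · rw [Finset.sum_eq_zero]
      · simp [atomVec, hax, haz]
      · intro s hs
        simp only [mem_filter, mem_univ, true_and] at hs
        have : ¬ a.1 ≤ s := fun h => haz (h.trans hs.2)
        simp [atomVec, hax, this]
  simpa only [atomSum, map_sub, map_sum] using congrArg (ExteriorAlgebra.ι ℤ) this

/-- The flag relation: a gap above the top of a flag vector may be filled in all possible ways. -/
theorem atomSum_mul_flagVec {k : ℕ} {u : Fin k → P} {z : P} (hz : tupleTop u ≤ z) :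
    atomSum z * flagVec u =
      ∑ s ∈ univ.filter (fun s => tupleTop u ⋖ s ∧ s ≤ z), atomSum s * flagVec u := by
  have := congrArg (· * flagVec u) (atomSum_sub hz)
  simpa only [sub_mul, Finset.sum_mul, atomSum_top_mul_flagVec, sub_zero] using this

/-- The flag relation with the term of one fixed cover `x` isolated. -/
theorem atomSum_mul_flagVec_sub {k : ℕ} {u : Fin k → P} {x z : P} (hx : tupleTop u ⋖ x)
    (hz : x ≤ z) :
    atomSum x * flagVec u = atomSum z * flagVec u -
      ∑ s ∈ univ.filter (fun s => (tupleTop u ⋖ s ∧ s ≤ z) ∧ s ≠ x), atomSum s * flagVec u := by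
  rw [atomSum_mul_flagVec (hx.le.trans hz), ← Finset.add_sum_erase _ _
    (show x ∈ univ.filter (fun s => tupleTop u ⋖ s ∧ s ≤ z) by simpa using ⟨hx, hz⟩),
    eq_sub_iff_add_eq, add_right_inj]
  refine Finset.sum_congr ?_ fun _ _ => rfl
  ext s
  simp [and_comm]

/-- The vectors `e(s) ∧ η(u)`, for neat chains `u` of length `k` whose top is covered by `s` and
does not lie above `a`. -/
def coverFamily (l : P → P) (k : ℕ) (s a : P) : Set (ExteriorAlgebra ℤ (Atoms P → ℤ)) :=
  {v | ∃ u : Fin k → P, IsNeat l u ∧ tupleTop u ⋖ s ∧ ¬ a ≤ tupleTop u ∧ v = atomSum s * flagVec u}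

/-- The straightening step: the penultimate element of a chain can be moved off any atom below the
top of the chain. -/
theorem atomSum_mul_flagVec_mem_span {l : P → P} (hl : IsAtomLabeling l) {k : ℕ} :
    ∀ {u : Fin k → P} {s a : P}, IsNeat l u → tupleTop u ⋖ s → IsAtom a → a ≤ s →
      atomSum s * flagVec u ∈ Submodule.span ℤ (coverFamily l k s a) := by
  induction k with
  | zero =>
    intro u s a hu hus ha has
    exact Submodule.subset_span ⟨u, hu, hus, fun h => ha.1 (le_bot_iff.1 h), rfl⟩
  | succ k ih =>
    intro u s a hu hus ha has
    by_cases hau : a ≤ tupleTop u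
    swap
    · exact Submodule.subset_span ⟨u, hu, hus, hau, rfl⟩
    rw [flagVec_succ]
    refine atomSum_mul_mem_span ?_ (ih hu.1 hu.2.1 ha hau)
    rintro _ ⟨u', hu', hu's, hau', rfl⟩
    rw [tupleTop_succ] at hus hau
    -- The flag relation above `tupleTop u'`, multiplied by `e(s)`, which kills its left-hand side.
    rw [atomSum_mul_flagVec_sub hu's hus.le, mul_sub, atomSum_mul_cancel, zero_sub,
      Finset.mul_sum]
    refine neg_mem (sum_mem fun t ht => ?_)
    simp only [mem_filter, mem_univ, true_and] at ht
    have hts : t ⋖ s := covBy_of_diamond hu's hus ht.1.1 ht.1.2 ht.2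
    have hat : ¬ a ≤ t := fun h => ht.2 (eq_of_covBy ha hau' ht.1.1 h hu's hau)
    obtain ⟨hlt, hlt'⟩ := hl t (bot_le.trans_lt ht.1.1.lt).ne'
    refine atomSum_mul_mem_span ?_ (ih hu' ht.1.1 hlt hlt')
    rintro _ ⟨u₂, hu₂, hu₂t, hlu₂, rfl⟩
    refine Submodule.subset_span ⟨Fin.cons t u₂, isNeat_cons.2 ⟨hu₂, hu₂t, hlu₂⟩, ?_, ?_, ?_⟩
    · simpa using hts
    · simpa using hat
    · rw [flagVec_cons]

theorem atomSum_mul_flagVec_mem_neat {l : P → P} (hl : IsAtomLabeling l) {k : ℕ} {u : Fin k → P}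
    {s : P} (hu : IsNeat l u) (hus : tupleTop u ⋖ s) :
    atomSum s * flagVec u ∈ Submodule.span ℤ (neatFamily l (k + 1) (· = s)) := by
  obtain ⟨h1, h2⟩ := hl s (bot_le.trans_lt hus.lt).ne'
  refine Submodule.span_mono ?_ (atomSum_mul_flagVec_mem_span hl hu hus h1 h2)
  rintro _ ⟨u', hu', hu's, hau', rfl⟩
  exact ⟨Fin.cons s u', isNeat_cons.2 ⟨hu', hu's, hau'⟩, by simp, (flagVec_cons _ _).symm⟩

/-- Flag vectors of arbitrary weakly descending tuples are spanned by those of neat chains. -/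
theorem flagVec_mem_span_neat {l : P → P} (hl : IsAtomLabeling l) {k : ℕ} :
    ∀ {u : Fin k → P} {y : P}, Antitone u → (∀ i, u i ≤ y) →
      flagVec u ∈ Submodule.span ℤ (neatFamily l k (· ≤ y)) := by
  induction k with
  | zero =>
    intro u y _ _
    exact Submodule.subset_span ⟨u, isNeat_zero l u, by simp, rfl⟩
  | succ k ih =>
    intro u y hu huy
    rw [flagVec_succ]
    refine atomSum_mul_mem_span ?_ (ih (u := Fin.tail u) (y := u 0)
      (fun i j hij => hu (Fin.succ_le_succ_iff.2 hij)) (fun i => hu (Fin.zero_le _)))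
    rintro _ ⟨u', hu', hu'y, rfl⟩
    rw [atomSum_mul_flagVec hu'y]
    refine sum_mem fun s hs => ?_
    simp only [mem_filter, mem_univ, true_and] at hs
    refine Submodule.span_mono (neatFamily_mono l _ ?_) (atomSum_mul_flagVec_mem_neat hl hu' hs.1)
    rintro x rfl
    exact hs.2.trans (huy 0)

/-- Below `y`, the flag vectors of length `k + 1` are spanned by the neat chains whose top avoids a
fixed atom `a` together with the products of `e(y)` and such chains of length `k`. -/
theorem neatFamily_le_span_union {l : P → P} (hl : IsAtomLabeling l) {a y : P} (ha : IsAtom a)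
    (k : ℕ) {v : ExteriorAlgebra ℤ (Atoms P → ℤ)}
    (hv : v ∈ Submodule.span ℤ (neatFamily l (k + 1) (· ≤ y))) :
    v ∈ Submodule.span ℤ (neatFamily l (k + 1) (AvoidsBelow a y) ∪
      atomSumImage y (neatFamily l k (AvoidsBelow a y))) := by
  refine Submodule.span_le.2 ?_ hv
  rintro _ ⟨u, hu, huy, rfl⟩
  rw [SetLike.mem_coe]
  by_cases hau : a ≤ tupleTop u
  swap
  · exact Submodule.subset_span (Or.inl ⟨u, hu, ⟨huy, hau⟩, rfl⟩)
  rw [flagVec_succ]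
  refine Submodule.span_le.2 ?_ (atomSum_mul_flagVec_mem_span hl hu.1 hu.2.1 ha hau)
  rintro _ ⟨u', hu', hu's, hau', rfl⟩
  rw [tupleTop_succ] at huy hau
  rw [SetLike.mem_coe, atomSum_mul_flagVec_sub hu's huy]
  refine sub_mem
    (Submodule.subset_span (Or.inr ⟨_, ⟨u', hu', ⟨hu's.le.trans huy, hau'⟩, rfl⟩, rfl⟩))
    (sum_mem fun t ht => ?_)
  simp only [mem_filter, mem_univ, true_and] at ht
  refine Submodule.span_mono (Set.subset_union_of_subset_left (neatFamily_mono l _ ?_) _)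
    (atomSum_mul_flagVec_mem_neat hl hu' ht.1.1)
  rintro x rfl
  exact ⟨ht.1.2, fun h => ht.2 (eq_of_covBy ha hau' ht.1.1 h hu's hau)⟩

/-- Multiplication by `e(y)` kills the second part of the spanning family. -/
theorem atomSum_mul_flagVec_mem_image {l : P → P} (hl : IsAtomLabeling l) {a y : P} (ha : IsAtom a)
    {k : ℕ} {u : Fin k → P} (hu : Antitone u) (huy : ∀ i, u i ≤ y) :
    atomSum y * flagVec u ∈
      Submodule.span ℤ (atomSumImage y (neatFamily l k (AvoidsBelow a y))) := by
  cases k with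
  | zero =>
    refine Submodule.subset_span ⟨_, ⟨u, isNeat_zero l u, ⟨bot_le, fun h => ?_⟩, rfl⟩, rfl⟩
    exact ha.1 (le_bot_iff.1 h)
  | succ k =>
    refine atomSum_mul_mem_span ?_
      (neatFamily_le_span_union hl ha k (flagVec_mem_span_neat hl hu huy))
    rintro v (hv | ⟨v', hv', rfl⟩)
    · exact Submodule.subset_span ⟨v, hv, rfl⟩
    · simp only [atomSum_mul_cancel, zero_mem]

end FlagVectors

/-! ### Gram determinants of flag vectors -/

section DetFunctional

variable {M S : Type*} [AddCommGroup M] [CommRing S]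

/-- The functional on the exterior algebra given on a product of `k` vectors `m_i` by
`det (φ_j m_i)`, and by zero in the other degrees. -/
noncomputable def detFunctional {k : ℕ} (φ : Fin k → M →ₗ[ℤ] S) : ExteriorAlgebra ℤ M →ₗ[ℤ] S :=
  ExteriorAlgebra.liftAlternating (Pi.single k
    { toMultilinearMap :=
        ((Matrix.detRowAlternating (R := S) (n := Fin k)).toMultilinearMap.restrictScalars
          ℤ).compLinearMap fun _ => LinearMap.pi φ
      map_eq_zero_of_eq' := fun _ _ _ h hij =>
        (Matrix.detRowAlternating (R := S) (n := Fin k)).map_eq_zero_of_eq _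
          (congrArg (LinearMap.pi φ) h) hij })

theorem detFunctional_ιMulti {k : ℕ} (φ : Fin k → M →ₗ[ℤ] S) (m : Fin k → M) :
    detFunctional φ (ExteriorAlgebra.ιMulti ℤ k m) = (Matrix.of fun i j => φ j (m i)).det := by
  rw [detFunctional, ExteriorAlgebra.liftAlternating_apply_ιMulti, Pi.single_eq_same]
  rfl

end DetFunctional

section Gram

variable {P : Type*} [PartialOrder P] [OrderBot P] [Fintype P] {R : Type*} [CommRing R]

/-- The weight of `x`: the sum of the weights of the atoms below `x`. -/
noncomputable def atomWeight (w : P → R) (x : P) : R :=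
  ∑ a ∈ univ.filter (fun a => IsAtom a ∧ a ≤ x), w a

/-- The sum of the weights of the atoms below both `x` and `y`. -/
noncomputable def commonWeight (w : P → R) (x y : P) : R :=
  ∑ a ∈ univ.filter (fun a => IsAtom a ∧ a ≤ x ∧ a ≤ y), w a

/-- The inner product of two flag vectors for the weighted form on the exterior algebra. -/
noncomputable def tupleGram (w : P → R) {k : ℕ} (u v : Fin k → P) : R :=
  (Matrix.of fun i j => commonWeight w (u i) (v j)).det

theorem commonWeight_comm (w : P → R) (x y : P) : commonWeight w x y = commonWeight w y x := by
  unfold commonWeight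
  congr 1
  ext a
  simp only [mem_filter, mem_univ, true_and]
  tauto

theorem commonWeight_of_le (w : P → R) {x y : P} (h : x ≤ y) :
    commonWeight w x y = atomWeight w x := by
  unfold commonWeight atomWeight
  congr 1
  ext a
  simp only [mem_filter, mem_univ, true_and]
  exact ⟨fun h' => ⟨h'.1, h'.2.1⟩, fun h' => ⟨h'.1, h'.2, h'.2.trans h⟩⟩

theorem tupleGram_comm (w : P → R) {k : ℕ} (u v : Fin k → P) :
    tupleGram w u v = tupleGram w v u := by
  rw [tupleGram, ← Matrix.det_transpose, tupleGram]
  congr 1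
  ext i j
  exact commonWeight_comm w _ _

/-- The pairing of a vector with `∑ w(a) a`, over the atoms `a ≤ x`. -/
noncomputable def weightFunctional (w : P → R) (x : P) : (Atoms P → ℤ) →ₗ[ℤ] R :=
  ∑ a : Atoms P, (LinearMap.toSpanSingleton ℤ R (if a.1 ≤ x then w a.1 else 0)).comp
    (LinearMap.proj a)

theorem weightFunctional_atomVec (w : P → R) (x y : P) :
    weightFunctional w y (atomVec x) = commonWeight w x y := by
  simp only [weightFunctional, LinearMap.sum_apply, LinearMap.comp_apply, LinearMap.proj_apply,
    LinearMap.toSpanSingleton_apply, atomVec, commonWeight]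
  rw [← Finset.filter_filter, Finset.sum_filter,
    ← Finset.sum_subtype (univ.filter fun a : P => IsAtom a) (by simp)
      (fun a => (if a ≤ x then (1 : ℤ) else 0) • (if a ≤ y then w a else 0))]
  refine Finset.sum_congr rfl fun a _ => ?_
  by_cases hx : a ≤ x <;> by_cases hy : a ≤ y <;> simp [hx, hy]

/-- The Gram form against a fixed flag vector, as a functional on the exterior algebra. -/
theorem exists_tupleGram_functional (w : P → R) {k : ℕ} (v : Fin k → P) :
    ∃ F : ExteriorAlgebra ℤ (Atoms P → ℤ) →ₗ[ℤ] R,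
      ∀ u : Fin k → P, F (flagVec u) = tupleGram w u v := by
  refine ⟨detFunctional fun j => weightFunctional w (v j), fun u => ?_⟩
  rw [flagVec, detFunctional_ιMulti]
  simp only [weightFunctional_atomVec, tupleGram]

/-- Linear relations between flag vectors carry over to the Gram form. -/
theorem tupleGram_eq_sum (w : P → R) {k : ℕ} {ι : Type*} [Fintype ι] {u : ι → Fin k → P}
    {c : ι → ℤ} {u₀ : Fin k → P} (h : flagVec u₀ = ∑ i, c i • flagVec (u i)) (v : Fin k → P) :
    tupleGram w u₀ v = ∑ i, (c i : R) * tupleGram w (u i) v := by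
  obtain ⟨F, hF⟩ := exists_tupleGram_functional w v
  rw [← hF, h, map_sum]
  exact Finset.sum_congr rfl fun i _ => by rw [map_smul, hF, zsmul_eq_mul]

/-- Two families of flag vectors with unimodular transition matrices have the same Gram
determinant. -/
theorem det_tupleGram_eq (w : P → R) {k : ℕ} {ι κ : Type*} [Fintype ι] [Fintype κ]
    [DecidableEq ι] [DecidableEq κ]
    (u : ι → Fin k → P) (v : κ → Fin k → P) (U : Matrix κ ι ℤ) (V : Matrix ι κ ℤ)
    (hU : ∀ j, flagVec (v j) = ∑ i, U j i • flagVec (u i)) (hUV : U * V = 1) (hVU : V * U = 1) :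
    (Matrix.of fun j j' => tupleGram w (v j) (v j')).det =
      (Matrix.of fun i i' => tupleGram w (u i) (u i')).det := by
  have e := Matrix.indexEquivOfInv hUV hVU
  have hsq : (U.submatrix id e).det * (U.submatrix id e).det = 1 := by
    refine Int.isUnit_mul_self (Int.isUnit_iff.2 (Int.isUnit_iff.1 ?_))
    refine IsUnit.of_mul_eq_one ((V.submatrix e id).det) ?_
    rw [← Matrix.det_mul, Matrix.submatrix_mul_equiv, hUV]
    simp
  have hG : (Matrix.of fun j j' => tupleGram w (v j) (v j')) =
      (U.submatrix id e).map (Int.castRingHom R) *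
        ((Matrix.of fun i i' => tupleGram w (u i) (u i')).submatrix e e) *
        ((U.submatrix id e).map (Int.castRingHom R)).transpose := by
    ext j j'
    rw [Matrix.mul_apply, Matrix.of_apply, tupleGram_comm, tupleGram_eq_sum w (hU j'),
      ← e.sum_comp]
    refine Finset.sum_congr rfl fun i _ => ?_
    rw [tupleGram_comm, tupleGram_eq_sum w (hU j), Matrix.mul_apply, ← e.sum_comp]
    simp [mul_comm]
  rw [hG, Matrix.det_mul, Matrix.det_mul, Matrix.det_transpose, Matrix.det_submatrix_equiv_self,
    mul_right_comm, ← RingHom.mapMatrix_apply, ← RingHom.map_det, ← map_mul, hsq, map_one, one_mul]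

/-- Gram determinants of a family with dual functionals and of a second family spanning the same
lattice, which is unitriangular with respect to some functionals, agree. -/
theorem det_tupleGram_eq_of_span (w : P → R) {k : ℕ} {ι κ : Type*} [Fintype ι] [Fintype κ]
    [DecidableEq ι] [DecidableEq κ]
    (u : ι → Fin k → P) (v : κ → Fin k → P)
    (δ : ι → ExteriorAlgebra ℤ (Atoms P → ℤ) →ₗ[ℤ] ℤ)
    (hδ : ∀ i j, δ j (flagVec (u i)) = if i = j then 1 else 0)
    (ε : κ → ExteriorAlgebra ℤ (Atoms P → ℤ) →ₗ[ℤ] ℤ)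
    (hε : (Matrix.of fun i j => ε j (flagVec (v i))).det = 1)
    (huv : ∀ i, flagVec (u i) ∈ Submodule.span ℤ (Set.range fun j => flagVec (v j)))
    (hvu : ∀ j, flagVec (v j) ∈ Submodule.span ℤ (Set.range fun i => flagVec (u i))) :
    (Matrix.of fun j j' => tupleGram w (v j) (v j')).det =
      (Matrix.of fun i i' => tupleGram w (u i) (u i')).det := by
  choose V hV using fun i => (Submodule.mem_span_range_iff_exists_fun ℤ).1 (huv i)
  choose U hU using fun j => (Submodule.mem_span_range_iff_exists_fun ℤ).1 (hvu j)
  have hδv : ∀ i j, δ i (flagVec (v j)) = U j i := fun i j => by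
    rw [← hU j, map_sum]
    simp only [map_smul, hδ, smul_eq_mul, mul_ite, mul_one, mul_zero, Finset.sum_ite_eq',
      mem_univ, if_true]
  have hVU : Matrix.of V * Matrix.of U = 1 := by
    ext i j
    rw [Matrix.mul_apply, Matrix.one_apply, ← hδ i j, ← hV i, map_sum]
    simp only [map_smul, hδv, smul_eq_mul, Matrix.of_apply]
  set Ξ := Matrix.of fun i j => ε j (flagVec (v i)) with hΞ
  have hUY : Matrix.of U * (Matrix.of fun i j => ε j (flagVec (u i))) = Ξ := by
    ext i j
    rw [Matrix.mul_apply, hΞ, Matrix.of_apply, ← hU i, map_sum]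
    simp only [map_smul, smul_eq_mul, Matrix.of_apply]
  have hUX : Matrix.of U * ((Matrix.of fun i j => ε j (flagVec (u i))) * Ξ⁻¹) = 1 := by
    rw [← Matrix.mul_assoc, hUY, Matrix.mul_nonsing_inv]
    simp [hε]
  have hVX : Matrix.of V = (Matrix.of fun i j => ε j (flagVec (u i))) * Ξ⁻¹ := by
    have := congrArg (Matrix.of V * ·) hUX
    simpa only [← Matrix.mul_assoc, hVU, Matrix.one_mul, Matrix.mul_one] using this.symm
  refine det_tupleGram_eq w u v (Matrix.of U) (Matrix.of V) (fun j => (hU j).symm) ?_ hVU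
  rw [hVX, hUX]

/-- Laplace expansion along the column of `y`. -/
theorem tupleGram_cons_cons (w : P → R) {k : ℕ} {y : P} {u : Fin k → P} (hu : ∀ i, u i ≤ y)
    (v : Fin k → P) :
    tupleGram w (Fin.cons y u : Fin (k + 1) → P) (Fin.cons y v : Fin (k + 1) → P) =
      atomWeight w y * tupleGram w u v + ∑ p : Fin k, (-1) ^ (p.1 + 1) * atomWeight w (u p) *
        tupleGram w (fun q => (Fin.cons y u : Fin (k + 1) → P) (p.succ.succAbove q)) v := by
  rw [tupleGram, Matrix.det_succ_column_zero, Fin.sum_univ_succ]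
  congr 1
  · simp only [Fin.val_zero, pow_zero, one_mul, Matrix.of_apply, Fin.cons_zero,
      commonWeight_of_le w le_rfl]
    rfl
  · refine Finset.sum_congr rfl fun p _ => ?_
    simp only [Fin.val_succ, Matrix.of_apply, Fin.cons_zero, Fin.cons_succ,
      commonWeight_of_le w (hu p)]
    rfl

end Gram

/-! ### Coordinates with respect to neat chains -/

section Coordinates

variable {P : Type*} [PartialOrder P] [OrderBot P]

/-- The coefficient of `b₀ ∧ ⋯ ∧ b_{k-1}`, for a tuple of atoms. -/
noncomputable def atomCoeff {k : ℕ} (b : Fin k → P) : ExteriorAlgebra ℤ (Atoms P → ℤ) →ₗ[ℤ] ℤ :=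
  detFunctional fun q => if h : IsAtom (b q) then LinearMap.proj ⟨b q, h⟩ else 0

theorem atomCoeff_flagVec {k : ℕ} {b : Fin k → P} (hb : ∀ q, IsAtom (b q)) (u : Fin k → P) :
    atomCoeff b (flagVec u) = (Matrix.of fun p q => if b q ≤ u p then (1 : ℤ) else 0).det := by
  rw [atomCoeff, flagVec, detFunctional_ιMulti]
  congr 1
  ext p q
  simp [hb q, atomVec]

/-- If the first atom lies below the first entry only, it can be split off. -/
theorem atomCoeff_flagVec_succ {k : ℕ} {b : Fin (k + 1) → P} (hb : ∀ q, IsAtom (b q))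
    {u : Fin (k + 1) → P} (h0 : b 0 ≤ u 0) (h1 : ∀ p, ¬ b 0 ≤ Fin.tail u p) :
    atomCoeff b (flagVec u) = atomCoeff (Fin.tail b) (flagVec (Fin.tail u)) := by
  rw [atomCoeff_flagVec hb, atomCoeff_flagVec (b := Fin.tail b) (fun q => hb q.succ),
    Matrix.det_succ_column_zero, Fin.sum_univ_succ, Finset.sum_eq_zero]
  · simp only [Fin.val_zero, pow_zero, Matrix.of_apply, h0, if_true, one_mul, add_zero]
    rfl
  · intro p _
    simp [show ¬ b 0 ≤ u p.succ from h1 p]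

theorem atomCoeff_flagVec_eq_zero {k : ℕ} {b : Fin k → P} (hb : ∀ q, IsAtom (b q))
    {u : Fin k → P} (q : Fin k) (hq : ∀ p, ¬ b q ≤ u p) : atomCoeff b (flagVec u) = 0 := by
  rw [atomCoeff_flagVec hb]
  exact Matrix.det_eq_zero_of_column_eq_zero q fun p => by simp [hq p]

theorem IsNeat.isAtom_label {l : P → P} (hl : IsAtomLabeling l) {k : ℕ} {u : Fin k → P}
    (hu : IsNeat l u) (q : Fin k) : IsAtom (l (u q)) :=
  (hl _ (hu.ne_bot q)).1

variable [LocallyGeometric P]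

theorem IsNeat.top_le {l : P → P} (hl : IsAtomLabeling l) {k : ℕ} {u : Fin k → P}
    (hu : IsNeat l u) {z : P} (h : ∀ q, l (u q) ≤ z) : tupleTop u ≤ z := by
  induction k with
  | zero => exact bot_le
  | succ k ih =>
    exact LocallyGeometric.le_of_covBy (hu.isAtom_label hl 0) hu.2.2 hu.2.1
      (hl _ (hu.ne_bot 0)).2 (ih hu.1 fun q => h q.succ) (h 0)

variable [Fintype P]

/-- The label tuples of the neat chains form a dual basis of their flag vectors. -/
theorem atomCoeff_label {l : P → P} (hl : IsAtomLabeling l) {k : ℕ} {u v : Fin k → P}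
    (hu : IsNeat l u) (hv : IsNeat l v) :
    atomCoeff (fun q => l (v q)) (flagVec u) = if u = v then 1 else 0 := by
  induction k with
  | zero => simp [atomCoeff_flagVec, Subsingleton.elim u v]
  | succ k ih =>
    by_cases h0 : u 0 = v 0
    · rw [atomCoeff_flagVec_succ (hv.isAtom_label hl) (h0 ▸ (hl _ (hu.ne_bot 0)).2)
        (fun p hp => hu.2.2 (h0 ▸ hp.trans (hu.1.le_top p)))]
      refine (ih hu.1 hv.1).trans (if_congr ⟨fun h => ?_, congrArg Fin.tail⟩ rfl rfl)
      rw [← Fin.cons_self_tail u, ← Fin.cons_self_tail v, h0, h]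
    · rw [if_neg fun h => h0 (congrFun h 0)]
      -- Otherwise `v 0`, the join of the labels of `v`, would lie strictly below `u 0`.
      obtain ⟨q, hq⟩ : ∃ q, ¬ l (v q) ≤ u 0 := by
        by_contra! h
        have hlt := posetRank_lt (lt_of_le_of_ne (hv.top_le hl h) (Ne.symm h0))
        have h1 := hu.posetRank_top
        have h2 := hv.posetRank_top
        rw [tupleTop_succ] at h1 h2 hlt
        omega
      exact atomCoeff_flagVec_eq_zero (hv.isAtom_label hl) q
        fun p hp => hq (hp.trans (hu.le_top p))

end Coordinates

/-! ### Orthogonality of flag vectors with different tops -/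

/-- A matrix that vanishes between the fibres of a map is block diagonal. -/
theorem det_eq_prod_fiber {m α R : Type*} [Fintype m] [DecidableEq m] [Fintype α] [CommRing R]
    (M : Matrix m m R) (f : m → α) (h : ∀ i j, f i ≠ f j → M i j = 0) :
    M.det = ∏ x : α, (Matrix.of fun i j : {i // f i = x} => M i j).det := by
  let e := Fintype.equivFin α
  have hM : M.BlockTriangular (fun i => e (f i)) := fun i j hij =>
    h i j fun hf => hij.ne (congrArg e hf.symm)
  rw [hM.det_fintype, ← e.prod_comp]
  refine Finset.prod_congr rfl fun x _ => ?_
  let g : {i // f i = x} ≃ {i // e (f i) = e x} :=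
    Equiv.subtypeEquivRight fun i => e.apply_eq_iff_eq.symm
  rw [← Matrix.det_submatrix_equiv_self g]
  rfl

section Steps

variable {P : Type*} [PartialOrder P] [OrderBot P]

/-- The atoms of the `i`-th step of an ascending sequence: those below `x (i + 1)`, not `x i`. -/
def IsStepAtom {k : ℕ} (x : Fin (k + 1) → P) (i : Fin k) (a : P) : Prop :=
  IsAtom a ∧ a ≤ x i.succ ∧ ¬ a ≤ x i.castSucc

theorem le_last_of_isStepAtom {k : ℕ} {x : Fin (k + 1) → P}
    (hx : ∀ i : Fin k, x i.castSucc ⋖ x i.succ) {a : Fin k → P} (ha : ∀ i, IsStepAtom x i (a i))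
    (i : Fin k) : a i ≤ x (Fin.last k) :=
  (ha i).2.1.trans ((Fin.strictMono_iff_lt_succ.2 fun j => (hx j).lt).monotone (Fin.le_last _))

theorem le_of_isStepAtom [LocallyGeometric P] {k : ℕ} {x : Fin (k + 1) → P} (hx0 : x 0 = ⊥)
    (hx : ∀ i : Fin k, x i.castSucc ⋖ x i.succ) {a : Fin k → P} (ha : ∀ i, IsStepAtom x i (a i))
    {z : P} (haz : ∀ i, a i ≤ z) (i : Fin (k + 1)) : x i ≤ z := by
  induction i using Fin.induction with
  | zero => rw [hx0]; exact bot_le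
  | succ i ih =>
    exact LocallyGeometric.le_of_covBy (ha i).1 (ha i).2.2 (hx i) (ha i).2.1 ih (haz i)

end Steps

section Expansion

variable {P : Type*} [PartialOrder P] [OrderBot P] [Fintype P] {R : Type*} [CommRing R]

/-- The atoms below `z` are those below `x ≤ z` and the new ones. -/
theorem sum_filter_sub (w : P → R) (p : P → Prop) {x z : P} (hxz : x ≤ z) :
    ∑ a ∈ univ.filter (fun a => IsAtom a ∧ a ≤ z ∧ p a), w a =
      ∑ a ∈ univ.filter (fun a => (IsAtom a ∧ a ≤ z ∧ ¬ a ≤ x) ∧ p a), w a +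
        ∑ a ∈ univ.filter (fun a => IsAtom a ∧ a ≤ x ∧ p a), w a := by
  rw [← Finset.sum_filter_add_sum_filter_not _ (fun a => ¬ a ≤ x), filter_filter, filter_filter]
  congr 1
  · refine Finset.sum_congr ?_ fun _ _ => rfl
    ext a
    simp only [mem_filter, mem_univ, true_and]
    tauto
  · refine Finset.sum_congr ?_ fun _ _ => rfl
    ext a
    simp only [mem_filter, mem_univ, true_and, not_not]
    exact ⟨fun h => ⟨h.1.1, h.2, h.1.2.2⟩, fun h => ⟨⟨h.1, h.2.1.trans hxz, h.2.2⟩, h.2.1⟩⟩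

/-- Subtracting consecutive rows replaces the atoms below `x (i + 1)` by those of the
`i`-th step. -/
theorem det_commonWeight_eq_det_step_left (w : P → R) {k : ℕ} {x : Fin (k + 1) → P}
    (hx0 : x 0 = ⊥) (hx : ∀ i : Fin k, x i.castSucc ≤ x i.succ) (p : Fin k → P → Prop) :
    (Matrix.of fun i j => ∑ a ∈ univ.filter (fun a => IsAtom a ∧ a ≤ x i.succ ∧ p j a), w a).det =
      (Matrix.of fun i j => ∑ a ∈ univ.filter (fun a => IsStepAtom x i a ∧ p j a), w a).det := by
  cases k with
  | zero => simp
  | succ k =>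
    refine Matrix.det_eq_of_forall_row_eq_smul_add_pred (fun _ => 1) (fun j => ?_) fun i j => ?_
    · refine Finset.sum_congr ?_ fun _ _ => rfl
      ext a
      simp only [mem_filter, mem_univ, true_and, IsStepAtom, Fin.castSucc_zero, hx0]
      refine ⟨fun h => ⟨⟨h.1, h.2.1, fun h' => h.1.1 (le_bot_iff.1 h')⟩, h.2.2⟩,
        fun h => ⟨h.1.1, h.1.2.1, h.2⟩⟩
    · simp only [Matrix.of_apply, one_mul]
      rw [Fin.succ_castSucc, sum_filter_sub w (p j) (hx i.succ)]
      refine congrArg (· + _) (Finset.sum_congr ?_ fun _ _ => rfl)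
      ext a
      rw [mem_filter, mem_filter]
      rfl

/-- The Gram form of two ascending chains as a signed sum over atom tuples. -/
theorem tupleGram_eq_sum_perm (w : P → R) {k : ℕ} {x y : Fin (k + 1) → P}
    (hx0 : x 0 = ⊥) (hx : ∀ i : Fin k, x i.castSucc ≤ x i.succ)
    (hy0 : y 0 = ⊥) (hy : ∀ i : Fin k, y i.castSucc ≤ y i.succ) :
    tupleGram w (fun i => x i.succ) (fun j => y j.succ) =
      ∑ a : Fin k → P, ∑ σ : Equiv.Perm (Fin k),
        if (∀ i, IsStepAtom x i (a i)) ∧ ∀ i, IsStepAtom y i (a (σ i)) then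
          ((Equiv.Perm.sign σ : ℤ) : R) * ∏ i, w (a i) else 0 := by
  have h1 : tupleGram w (fun i => x i.succ) (fun j => y j.succ) = (Matrix.of fun i j =>
      ∑ a ∈ univ.filter (fun a => IsStepAtom x i a ∧ IsStepAtom y j a), w a).det := by
    refine (det_commonWeight_eq_det_step_left w hx0 hx (fun j a => a ≤ y j.succ)).trans ?_
    rw [← Matrix.det_transpose]
    have := det_commonWeight_eq_det_step_left w hy0 hy (fun i a => IsStepAtom x i a)
    rw [← Matrix.det_transpose (Matrix.of fun i j => ∑ a ∈ univ.filter
      (fun a => IsStepAtom x i a ∧ IsStepAtom y j a), w a)]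
    convert this using 2
    · ext i j
      refine Finset.sum_congr ?_ fun _ _ => rfl
      ext a
      simp only [mem_filter, mem_univ, true_and]
      exact ⟨fun h => ⟨h.1.1, h.2, h.1⟩, fun h => ⟨h.2.2, h.2.1⟩⟩
    · ext i j
      refine Finset.sum_congr ?_ fun _ _ => rfl
      ext a
      simp only [mem_filter, mem_univ, true_and]
      exact and_comm
  rw [h1, Matrix.det_apply, Finset.sum_comm]
  refine Finset.sum_congr rfl fun σ _ => ?_
  simp only [Matrix.of_apply, Finset.sum_filter]
  rw [Finset.prod_univ_sum, Fintype.piFinset_univ, Finset.smul_sum,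
    ← (Equiv.arrowCongr σ.symm (Equiv.refl P)).sum_comp]
  refine Finset.sum_congr rfl fun a _ => ?_
  have e : (Equiv.arrowCongr σ.symm (Equiv.refl P)) a = a ∘ σ := rfl
  simp only [e, Function.comp_apply]
  have hiff : (∀ i, IsStepAtom x (σ i) (a (σ i)) ∧ IsStepAtom y i (a (σ i))) ↔
      (∀ i, IsStepAtom x i (a i)) ∧ ∀ i, IsStepAtom y i (a (σ i)) := by
    rw [forall_and, σ.forall_congr_right (q := fun i => IsStepAtom x i (a i))]
  by_cases hall : (∀ i, IsStepAtom x i (a i)) ∧ ∀ i, IsStepAtom y i (a (σ i))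
  · rw [if_pos hall, Finset.prod_congr rfl fun i _ => if_pos (hiff.2 hall i),
      Equiv.prod_comp σ (fun i => w (a i)), Units.smul_def, zsmul_eq_mul]
  · rw [if_neg hall]
    obtain ⟨i, hi⟩ := not_forall.1 (fun h => hall (hiff.1 h))
    rw [Finset.prod_eq_zero (mem_univ i) (if_neg hi), smul_zero]

variable [LocallyGeometric P]

/-- The top is the join of any generating atom tuple, so no tuple generates both chains. -/
theorem tupleGram_eq_zero (w : P → R) {k : ℕ} {x y : Fin (k + 1) → P}
    (hx0 : x 0 = ⊥) (hx : ∀ i : Fin k, x i.castSucc ⋖ x i.succ)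
    (hy0 : y 0 = ⊥) (hy : ∀ i : Fin k, y i.castSucc ⋖ y i.succ)
    (hne : x (Fin.last k) ≠ y (Fin.last k)) :
    tupleGram w (fun i => x i.succ) (fun j => y j.succ) = 0 := by
  rw [tupleGram_eq_sum_perm w hx0 (fun i => (hx i).le) hy0 (fun i => (hy i).le)]
  refine Finset.sum_eq_zero fun a _ => Finset.sum_eq_zero fun σ _ => if_neg ?_
  rintro ⟨h1, h2⟩
  refine hne (le_antisymm (le_of_isStepAtom hx0 hx h1 (fun i => ?_) _)
    (le_of_isStepAtom (a := fun i => a (σ i)) hy0 hy h2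
      (fun i => le_last_of_isStepAtom hx h1 (σ i)) _))
  simpa using le_last_of_isStepAtom (a := fun i => a (σ i)) hy h2 (σ.symm i)

end Expansion

section Ascend

variable {P : Type*} [PartialOrder P] [OrderBot P]

/-- The ascending sequence `⊥, u (k - 1), …, u 0` of a descending tuple. -/
def ascend {k : ℕ} (u : Fin k → P) (i : Fin (k + 1)) : P :=
  (Fin.snoc u ⊥ : Fin (k + 1) → P) i.rev

theorem ascend_zero {k : ℕ} (u : Fin k → P) : ascend u 0 = ⊥ := by
  simp [ascend]

theorem ascend_succ {k : ℕ} (u : Fin k → P) (i : Fin k) : ascend u i.succ = u i.rev := by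
  simp [ascend, Fin.rev_succ]

theorem snoc_bot_zero {k : ℕ} (u : Fin k → P) :
    (Fin.snoc u ⊥ : Fin (k + 1) → P) 0 = tupleTop u := by
  cases k with
  | zero => rfl
  | succ k => exact Fin.snoc_castSucc (α := fun _ => P) ⊥ u 0

theorem ascend_last {k : ℕ} (u : Fin k → P) : ascend u (Fin.last k) = tupleTop u := by
  rw [ascend, Fin.rev_last, snoc_bot_zero]

theorem isNeat_iff_snoc {l : P → P} {k : ℕ} {u : Fin k → P} :
    IsNeat l u ↔ ∀ p : Fin k, (Fin.snoc u ⊥ : Fin (k + 1) → P) p.succ ⋖ u p ∧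
      ¬ l (u p) ≤ (Fin.snoc u ⊥ : Fin (k + 1) → P) p.succ := by
  induction k with
  | zero => exact ⟨fun _ p => p.elim0, fun _ => trivial⟩
  | succ k ih =>
    have hs : ∀ p : Fin (k + 1), (Fin.snoc u ⊥ : Fin (k + 2) → P) p.succ =
        (Fin.snoc (Fin.tail u) ⊥ : Fin (k + 1) → P) p := by
      intro p
      rw [← Fin.cons_self_tail u, ← Fin.cons_snoc_eq_snoc_cons]
      simp
    rw [Fin.forall_fin_succ]
    simp only [hs, snoc_bot_zero]
    exact ⟨fun h => ⟨h.2, ih.1 h.1⟩, fun h => ⟨ih.2 h.2, h.1⟩⟩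

theorem isNeat_iff_ascend {l : P → P} {k : ℕ} {u : Fin k → P} :
    IsNeat l u ↔ ∀ i : Fin k, ascend u i.castSucc ⋖ ascend u i.succ ∧
      ¬ l (ascend u i.succ) ≤ ascend u i.castSucc := by
  rw [isNeat_iff_snoc, ← Fin.revPerm.forall_congr_right]
  simp [ascend, Fin.rev_succ, Fin.rev_castSucc]

variable [Fintype P] {R : Type*} [CommRing R]

theorem tupleGram_eq_ascend (w : P → R) {k : ℕ} (u v : Fin k → P) :
    tupleGram w u v = tupleGram w (fun i => ascend u i.succ) (fun j => ascend v j.succ) := by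
  rw [tupleGram, ← Matrix.det_submatrix_equiv_self Fin.revPerm, tupleGram]
  simp only [ascend_succ]
  rfl

theorem IsNeat.tupleGram_eq_zero [LocallyGeometric P] (w : P → R) {l : P → P} {k : ℕ}
    {u v : Fin k → P} (hu : IsNeat l u) (hv : IsNeat l v) (hne : tupleTop u ≠ tupleTop v) :
    tupleGram w u v = 0 := by
  rw [tupleGram_eq_ascend]
  exact _root_.tupleGram_eq_zero w (ascend_zero u) (fun i => (isNeat_iff_ascend.1 hu i).1)
    (ascend_zero v) (fun i => (isNeat_iff_ascend.1 hv i).1) (by rwa [ascend_last, ascend_last])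

end Ascend

/-! ### The recursion for the Gram determinants -/

theorem antitone_cons {P : Type*} [PartialOrder P] {k : ℕ} {y : P} {u : Fin k → P}
    (hu : Antitone u) (huy : ∀ i, u i ≤ y) : Antitone (Fin.cons y u : Fin (k + 1) → P) := by
  intro i j hij
  induction i using Fin.cases with
  | zero => exact Fin.cases le_rfl (fun j => by simpa using huy j) j
  | succ i =>
    induction j using Fin.cases with
    | zero => exact absurd hij (by simp)
    | succ j => simpa using hu (Fin.succ_le_succ_iff.1 hij)

section Recursion

variable {P : Type*} [PartialOrder P] [OrderBot P]

/-- The neat chains of length `k` whose top satisfies `Q`. -/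
@[ext]
structure NeatTuple (l : P → P) (k : ℕ) (Q : P → Prop) where
  /-- The descending tuple of elements. -/
  tuple : Fin k → P
  isNeat : IsNeat l tuple
  top_prop : Q (tupleTop tuple)

theorem neatFamily_eq_range (l : P → P) (k : ℕ) (Q : P → Prop) :
    neatFamily l k Q = Set.range fun u : NeatTuple l k Q => flagVec u.1 := by
  ext v
  constructor
  · rintro ⟨u, h1, h2, rfl⟩
    exact ⟨⟨u, h1, h2⟩, rfl⟩
  · rintro ⟨⟨u, h1, h2⟩, rfl⟩
    exact ⟨u, h1, h2, rfl⟩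

theorem atomSumImage_eq_range (l : P → P) (k : ℕ) (y : P) (Q : P → Prop) :
    atomSumImage y (neatFamily l k Q) = Set.range fun u : NeatTuple l k Q =>
      flagVec (Fin.cons y u.1 : Fin (k + 1) → P) := by
  rw [atomSumImage, neatFamily_eq_range, ← Set.range_comp]
  simp only [flagVec_cons]
  rfl

/-- The neat chains with a prescribed top, as a fibre of the top map. -/
def NeatTuple.fiberEquiv (l : P → P) (k : ℕ) {Q : P → Prop} {x : P} (hx : Q x) :
    NeatTuple l k (· = x) ≃ {u : NeatTuple l k Q // tupleTop u.tuple = x} where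
  toFun u := ⟨⟨u.1, u.2, by rw [u.3]; exact hx⟩, u.3⟩
  invFun u := ⟨u.1.1, u.1.2, u.2⟩
  left_inv _ := rfl
  right_inv _ := rfl

variable [Fintype P] {R : Type*} [CommRing R]

noncomputable instance (l : P → P) (k : ℕ) (Q : P → Prop) : Fintype (NeatTuple l k Q) :=
  Fintype.ofInjective NeatTuple.tuple fun _ _ => NeatTuple.ext

noncomputable instance (l : P → P) (k : ℕ) (Q : P → Prop) : DecidableEq (NeatTuple l k Q) :=
  Classical.decEq _

/-- The Gram determinant of the flag vectors of the neat chains whose top satisfies `Q`. -/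
noncomputable def neatDet (w : P → R) (l : P → P) (k : ℕ) (Q : P → Prop) : R :=
  (Matrix.of fun u v : NeatTuple l k Q => tupleGram w u.1 v.1).det

/-- The Gram determinant of the products of `e(y)` with the flag vectors of the neat chains whose
top satisfies `Q`. -/
noncomputable def coneDet (w : P → R) (l : P → P) (k : ℕ) (y : P) (Q : P → Prop) : R :=
  (Matrix.of fun u v : NeatTuple l k Q => tupleGram w (Fin.cons y u.1 : Fin (k + 1) → P)
    (Fin.cons y v.1 : Fin (k + 1) → P)).det

variable [LocallyGeometric P]

theorem neatDet_eq_prod (w : P → R) (l : P → P) (k : ℕ) (Q : P → Prop) [DecidablePred Q] :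
    neatDet w l k Q = ∏ x ∈ univ.filter Q, neatDet w l k (· = x) := by
  unfold neatDet
  rw [det_eq_prod_fiber (Matrix.of fun u v : NeatTuple l k Q => tupleGram w u.1 v.1)
    (fun u : NeatTuple l k Q => tupleTop u.1)
    (fun u v h => u.isNeat.tupleGram_eq_zero w v.isNeat h), Finset.prod_filter]
  refine Finset.prod_congr rfl fun x _ => ?_
  split_ifs with hx
  · rw [← Matrix.det_submatrix_equiv_self (NeatTuple.fiberEquiv l k hx)]
    rfl
  · have : IsEmpty {u : NeatTuple l k Q // tupleTop u.1 = x} := ⟨fun u => hx (u.2 ▸ u.1.3)⟩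
    exact Matrix.det_isEmpty

/-- The family adapted to an atom `a`: the neat chains below `y` whose top avoids `a`, and `y`
followed by such chains of one length less. -/
def adaptedTuple (l : P → P) (a y : P) (k : ℕ) :
    NeatTuple l (k + 1) (AvoidsBelow a y) ⊕ NeatTuple l k (AvoidsBelow a y) → Fin (k + 1) → P
  | .inl u => u.1
  | .inr u => Fin.cons y u.1

/-- The atom tuples dual to the adapted family, up to a unitriangular matrix. -/
def adaptedAtoms (l : P → P) (a y : P) (k : ℕ) :
    NeatTuple l (k + 1) (AvoidsBelow a y) ⊕ NeatTuple l k (AvoidsBelow a y) → Fin (k + 1) → P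
  | .inl u => fun q => l (u.1 q)
  | .inr u => Fin.cons a fun q => l (u.1 q)

theorem atomCoeff_label_neatTuple {l : P → P} (hl : IsAtomLabeling l) {k : ℕ} {Q : P → Prop}
    (u v : NeatTuple l k Q) :
    atomCoeff (fun q => l (v.1 q)) (flagVec u.1) = if u = v then 1 else 0 :=
  (atomCoeff_label hl u.isNeat v.isNeat).trans (if_congr NeatTuple.ext_iff.symm rfl rfl)

theorem det_atomCoeff_adapted {l : P → P} (hl : IsAtomLabeling l) {a y : P}
    (ha : IsAtom a) (hay : a ≤ y) (k : ℕ) :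
    (Matrix.of fun i j => atomCoeff (adaptedAtoms l a y k j)
      (flagVec (adaptedTuple l a y k i))).det = 1 := by
  have hb : ∀ u : NeatTuple l k (AvoidsBelow a y),
      ∀ q, IsAtom ((Fin.cons a fun q => l (u.1 q) : Fin (k + 1) → P) q) := fun u q =>
    Fin.cases ha (fun q => by simpa using u.isNeat.isAtom_label hl q) q
  have hM : (Matrix.of fun i j => atomCoeff (adaptedAtoms l a y k j)
      (flagVec (adaptedTuple l a y k i))) = Matrix.fromBlocks 1 0 (Matrix.of fun i j =>
        atomCoeff (adaptedAtoms l a y k (.inl j)) (flagVec (adaptedTuple l a y k (.inr i)))) 1 := by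
    ext (u | u) (v | v)
    · rw [Matrix.fromBlocks_apply₁₁, Matrix.one_apply]
      exact atomCoeff_label_neatTuple hl u v
    · exact atomCoeff_flagVec_eq_zero (hb v) 0 fun p hp =>
        u.top_prop.2 (le_trans hp (u.isNeat.le_top p))
    · rfl
    · rw [Matrix.of_apply, Matrix.fromBlocks_apply₂₂, Matrix.one_apply,
        ← atomCoeff_label_neatTuple hl u v]
      exact atomCoeff_flagVec_succ (hb v) hay
        fun p hp => u.top_prop.2 (le_trans hp (u.isNeat.le_top p))
  rw [hM, Matrix.det_fromBlocks_zero₁₂, Matrix.det_one, Matrix.det_one, one_mul]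

/-- Replacing the neat chains below `y` by the adapted family does not change the Gram
determinant. -/
theorem det_adapted_eq_neatDet (w : P → R) {l : P → P} (hl : IsAtomLabeling l) {a y : P}
    (ha : IsAtom a) (hay : a ≤ y) (k : ℕ) :
    (Matrix.of fun j j' => tupleGram w (adaptedTuple l a y k j) (adaptedTuple l a y k j')).det =
      neatDet w l (k + 1) (· ≤ y) := by
  refine det_tupleGram_eq_of_span w (fun u : NeatTuple l (k + 1) (· ≤ y) => u.1)
    (adaptedTuple l a y k) (fun u => atomCoeff fun q => l (u.1 q)) (atomCoeff_label_neatTuple hl)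
    (fun j => atomCoeff (adaptedAtoms l a y k j)) (det_atomCoeff_adapted hl ha hay k)
    (fun i => ?_) (fun j => ?_)
  · have := neatFamily_le_span_union hl ha k (Submodule.subset_span
      (show flagVec i.1 ∈ neatFamily l (k + 1) (· ≤ y) from ⟨i.1, i.isNeat, i.top_prop, rfl⟩))
    refine Submodule.span_mono ?_ this
    rw [neatFamily_eq_range, atomSumImage_eq_range]
    rintro _ (⟨u, rfl⟩ | ⟨u, rfl⟩)
    · exact ⟨Sum.inl u, rfl⟩
    · exact ⟨Sum.inr u, rfl⟩
  · rw [← neatFamily_eq_range]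
    rcases j with u | u
    · exact Submodule.subset_span ⟨u.1, u.isNeat, u.top_prop.1, rfl⟩
    · have huy : ∀ i, u.1 i ≤ y := fun i => (u.isNeat.le_top i).trans u.top_prop.1
      exact flagVec_mem_span_neat hl (antitone_cons u.isNeat.antitone huy)
        fun i => Fin.cases le_rfl huy i

/-- The vector obtained from `e(y) ∧ η(u)` by deleting one factor of `η(u)` is a combination of
products of `e(y)` with neat chains whose top avoids `a`. -/
theorem exists_tupleGram_delete (w : P → R) {l : P → P} (hl : IsAtomLabeling l) {a y : P}
    (ha : IsAtom a) {k : ℕ} {u : Fin (k + 1) → P} (hu : Antitone u) (huy : ∀ i, u i ≤ y)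
    (p : Fin (k + 1)) :
    ∃ c : NeatTuple l k (AvoidsBelow a y) → ℤ, ∀ v : Fin (k + 1) → P,
      tupleGram w (fun q => (Fin.cons y u : Fin (k + 2) → P) (p.succ.succAbove q)) v =
        ∑ t, (c t : R) * tupleGram w (Fin.cons y t.1) v := by
  have hanti : Antitone (fun q => (Fin.cons y u : Fin (k + 2) → P) (p.succ.succAbove q)) :=
    (antitone_cons hu huy).comp_monotone (Fin.strictMono_succAbove _).monotone
  have h0 : (fun q => (Fin.cons y u : Fin (k + 2) → P) (p.succ.succAbove q)) 0 = y := by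
    simp
  have hmem := atomSum_mul_flagVec_mem_image (k := k) (u := Fin.tail (fun q =>
    (Fin.cons y u : Fin (k + 2) → P) (p.succ.succAbove q))) hl ha (y := y)
    (fun i j hij => hanti (Fin.succ_le_succ_iff.2 hij))
    (fun i => (hanti (Fin.zero_le _)).trans h0.le)
  rw [atomSumImage_eq_range, Submodule.mem_span_range_iff_exists_fun] at hmem
  obtain ⟨c, hc⟩ := hmem
  refine ⟨c, fun v => tupleGram_eq_sum w ?_ v⟩
  rw [hc, flagVec_succ]
  exact congrArg (fun x => atomSum x * _) h0.symm

/-- Laplace expansion along `y`, read as a row operation on the Gram matrix of the adapted family,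
makes it block triangular. -/
theorem neatDet_mul_pow (w : P → R) {l : P → P} (hl : IsAtomLabeling l) {a y : P}
    (ha : IsAtom a) (hay : a ≤ y) (k : ℕ) :
    neatDet w l (k + 1) (· ≤ y) *
        atomWeight w y ^ Fintype.card (NeatTuple l (k + 1) (AvoidsBelow a y)) =
      coneDet w l (k + 1) y (AvoidsBelow a y) *
        coneDet w l k y (AvoidsBelow a y) := by
  rw [← det_adapted_eq_neatDet w hl ha hay k]
  have huy : ∀ u : NeatTuple l (k + 1) (AvoidsBelow a y), ∀ i, u.1 i ≤ y :=
    fun u i => (u.isNeat.le_top i).trans u.top_prop.1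
  choose c hc using fun (u : NeatTuple l (k + 1) (AvoidsBelow a y)) =>
    exists_tupleGram_delete w hl ha u.isNeat.antitone (huy u)
  let Λ : Matrix (NeatTuple l (k + 1) (AvoidsBelow a y))
      (NeatTuple l k (AvoidsBelow a y)) R := Matrix.of fun u t =>
    ∑ p : Fin (k + 1), (-1) ^ (p.1 + 1) * atomWeight w (u.1 p) * (c u p t : R)
  have hrow : ∀ (u : NeatTuple l (k + 1) (AvoidsBelow a y)) (v : Fin (k + 1) → P),
      atomWeight w y * tupleGram w u.1 v + ∑ t, Λ u t * tupleGram w (Fin.cons y t.1) v =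
        tupleGram w (Fin.cons y u.1 : Fin (k + 2) → P) (Fin.cons y v : Fin (k + 2) → P) := by
    intro u v
    rw [tupleGram_cons_cons w (huy u)]
    congr 1
    simp only [hc, Λ, Matrix.of_apply, Finset.sum_mul, Finset.mul_sum]
    rw [Finset.sum_comm]
    exact Finset.sum_congr rfl fun p _ => Finset.sum_congr rfl fun t _ => by ring
  have hL : (Matrix.fromBlocks (atomWeight w y • 1) Λ 0 1).det =
      atomWeight w y ^ Fintype.card (NeatTuple l (k + 1) (AvoidsBelow a y)) := by
    rw [Matrix.det_fromBlocks_zero₂₁, Matrix.det_smul, Matrix.det_one, Matrix.det_one, mul_one,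
      mul_one]
  have hmul : Matrix.fromBlocks (atomWeight w y • 1) Λ 0 1 *
      (Matrix.of fun j j' => tupleGram w (adaptedTuple l a y k j) (adaptedTuple l a y k j')) =
      Matrix.fromBlocks
        (Matrix.of fun u v => tupleGram w (Fin.cons y u.1 : Fin (k + 2) → P) (Fin.cons y v.1)) 0
        (Matrix.of fun i j => tupleGram w (adaptedTuple l a y k (.inr i))
          (adaptedTuple l a y k (.inl j)))
        (Matrix.of fun u v => tupleGram w (Fin.cons y u.1 : Fin (k + 1) → P) (Fin.cons y v.1)) := by
    ext (u | u) j
    · rw [Matrix.mul_apply, Fintype.sum_sum_type]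
      simp only [Matrix.fromBlocks_apply₁₁, Matrix.fromBlocks_apply₁₂, Matrix.smul_apply,
        Matrix.one_apply, smul_eq_mul, mul_ite, mul_one, mul_zero, ite_mul, zero_mul,
        Finset.sum_ite_eq, mem_univ, if_true]
      refine (hrow u (adaptedTuple l a y k j)).trans ?_
      rcases j with v | v
      · rfl
      · -- The column of `y` occurs twice.
        exact Matrix.det_zero_of_column_eq (i := 0) (j := Fin.succ 0) (Fin.succ_ne_zero 0).symm
          fun i => rfl
    · rw [Matrix.mul_apply, Fintype.sum_sum_type]
      simp only [Matrix.fromBlocks_apply₂₁, Matrix.fromBlocks_apply₂₂, Matrix.zero_apply,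
        Matrix.one_apply, zero_mul, ite_mul, one_mul, Finset.sum_ite_eq, mem_univ, if_true,
        Finset.sum_const_zero, zero_add]
      rcases j with v | v <;> rfl
  rw [mul_comm, ← hL, ← Matrix.det_mul, hmul, Matrix.det_fromBlocks_zero₁₂]
  rfl

end Recursion

/-! ### Evaluation of the Gram determinants -/

theorem card_neatTuple_eq_sum {P : Type*} [PartialOrder P] [OrderBot P] [Fintype P] (l : P → P)
    (k : ℕ) (Q : P → Prop) [DecidablePred Q] :
    Fintype.card (NeatTuple l k Q) =
      ∑ x ∈ univ.filter Q, Fintype.card (NeatTuple l k (· = x)) := by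
  rw [← Finset.card_univ, Finset.card_eq_sum_card_fiberwise (f := fun u => tupleTop u.tuple)
    (t := univ.filter Q) (fun u _ => by simpa using u.top_prop)]
  refine Finset.sum_congr rfl fun x hx => ?_
  rw [Fintype.card_congr (NeatTuple.fiberEquiv l k (by simpa using hx)), Fintype.card_subtype]

section Count

variable {P : Type*} [PartialOrder P] [OrderBot P] [Fintype P] [LocallyGeometric P]

open LocallyGeometric

theorem isEmpty_neatTuple {l : P → P} {k : ℕ} {Q : P → Prop} (h : ∀ x, Q x → posetRank x ≠ k) :
    IsEmpty (NeatTuple l k Q) :=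
  ⟨fun u => h _ u.top_prop u.isNeat.posetRank_top⟩

/-- The number of neat chains that end in `x` is the absolute value of `μ(⊥, x)`. -/
theorem card_neatTuple {l : P → P} (hl : IsAtomLabeling l) (k : ℕ) (x : P) :
    (Fintype.card (NeatTuple l k (· = x)) : ℤ) =
      if posetRank x = k then (-1) ^ k * posetMoebius ⊥ x else 0 := by
  induction k generalizing x with
  | zero =>
    by_cases hx : x = ⊥
    · subst hx
      rw [if_pos posetRank_bot, posetMoebius_self, Fintype.card_eq_one_iff.2]
      · simp
      · exact ⟨⟨Fin.elim0, trivial, rfl⟩, fun u => NeatTuple.ext (Subsingleton.elim _ _)⟩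
    · have hr : posetRank x ≠ 0 := by
        have := posetRank_lt (bot_lt_iff_ne_bot.2 hx)
        omega
      have := isEmpty_neatTuple (l := l) (k := 0) (Q := (· = x)) (by rintro _ rfl; exact hr)
      rw [if_neg hr, Fintype.card_eq_zero, Nat.cast_zero]
  | succ k ih =>
    have e : NeatTuple l (k + 1) (· = x) ≃ NeatTuple l k (fun h => h ⋖ x ∧ ¬ l x ≤ h) :=
      { toFun := fun u => ⟨Fin.tail u.1, u.2.1, by
          have h := u.2.2
          rwa [show u.1 0 = x from u.3] at h⟩
        invFun := fun u => ⟨Fin.cons x u.1, isNeat_cons.2 ⟨u.2, u.3⟩, rfl⟩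
        left_inv := fun u => by
          refine NeatTuple.ext ?_
          have h : u.1 0 = x := u.3
          exact (congrArg (fun z => (Fin.cons z (Fin.tail u.1) : Fin (k + 1) → P)) h.symm).trans
            (Fin.cons_self_tail _)
        right_inv := fun u => NeatTuple.ext (Fin.tail_cons (α := fun _ => P) x u.1) }
    rw [Fintype.card_congr e, card_neatTuple_eq_sum, Nat.cast_sum]
    by_cases hr : posetRank x = k + 1
    · have hx : x ≠ ⊥ := by
        rintro rfl
        rw [posetRank_bot] at hr
        omega
      obtain ⟨h1, h2⟩ := hl x hx
      rw [if_pos hr, posetMoebius_eq_neg_sum h1 (fun h => h1.1 (le_bot_iff.1 h)) x h2,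
        ← Finset.sum_neg_distrib, Finset.mul_sum]
      refine Finset.sum_congr rfl fun h hh => ?_
      simp only [mem_filter, mem_univ, true_and] at hh
      have := posetRank_covBy hh.1
      rw [ih, if_pos (by omega), pow_succ]
      ring
    · rw [if_neg hr]
      refine Finset.sum_eq_zero fun h hh => ?_
      simp only [mem_filter, mem_univ, true_and] at hh
      have := posetRank_covBy hh.1
      rw [ih, if_neg (by omega)]

theorem sum_card_neatTuple {l : P → P} (hl : IsAtomLabeling l) (Q : P → Prop)
    [DecidablePred Q] {n : ℕ} (hn : ∀ x, Q x → posetRank x < n) :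
    ∑ k ∈ range n, (-1) ^ k * (Fintype.card (NeatTuple l k Q) : ℤ) =
      ∑ x ∈ univ.filter Q, posetMoebius ⊥ x := by
  simp only [card_neatTuple_eq_sum l _ Q, Nat.cast_sum, card_neatTuple hl, Finset.mul_sum]
  rw [Finset.sum_comm]
  refine Finset.sum_congr rfl fun x hx => ?_
  simp only [mem_filter, mem_univ, true_and] at hx
  rw [Finset.sum_eq_single (posetRank x)]
  · rw [if_pos rfl, ← mul_assoc, ← mul_pow]
    simp
  · intro k _ hk
    rw [if_neg hk.symm, mul_zero]
  · intro h
    exact absurd (mem_range.2 (hn x hx)) h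

end Count

theorem tupleGram_zero {P : Type*} [PartialOrder P] [OrderBot P] [Fintype P] {R : Type*}
    [CommRing R] (w : P → R) (u v : Fin 0 → P) :
    tupleGram w u v = 1 := Matrix.det_isEmpty

theorem posetRank_lt_of_avoidsBelow {P : Type*} [PartialOrder P] [Fintype P] {a y x : P}
    (hay : a ≤ y) (hx : AvoidsBelow a y x) :
    posetRank x < posetRank y :=
  posetRank_lt (lt_of_le_of_ne hx.1 fun h => hx.2 (h ▸ hay))

theorem LocallyGeometric.exists_atom_le {P : Type*} [PartialOrder P] [OrderBot P]
    [LocallyGeometric P] {x : P} (hx : x ≠ ⊥) : ∃ a, IsAtom a ∧ a ≤ x := by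
  obtain ⟨a, h1, h2, -⟩ := exists_atom ⊥ x (bot_lt_iff_ne_bot.2 hx)
  exact ⟨a, h1, h2⟩

theorem neatDet_zero {P : Type*} [PartialOrder P] [OrderBot P] [Fintype P] {R : Type*}
    [CommRing R] (w : P → R) (l : P → P) (Q : P → Prop) :
    neatDet w l 0 Q = 1 := by
  rw [neatDet, show (Matrix.of fun u v : NeatTuple l 0 Q => tupleGram w u.1 v.1) = 1 from ?_,
    Matrix.det_one]
  ext u v
  rw [Matrix.of_apply, tupleGram_zero, NeatTuple.ext (Subsingleton.elim u.1 v.1),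
    Matrix.one_apply_eq]

theorem coneDet_zero {P : Type*} [PartialOrder P] [OrderBot P] [Fintype P] {R : Type*}
    [CommRing R] (w : P → R) (l : P → P) {y : P} {Q : P → Prop} (hQ : Q ⊥) :
    coneDet w l 0 y Q = atomWeight w y := by
  have : Unique (NeatTuple l 0 Q) :=
    { default := ⟨Fin.elim0, trivial, hQ⟩
      uniq := fun u => NeatTuple.ext (Subsingleton.elim _ _) }
  rw [coneDet, Matrix.det_unique, Matrix.of_apply, tupleGram_cons_cons w (fun i => i.elim0),
    tupleGram_zero]
  simp

theorem exists_isAtomLabeling (P : Type*) [PartialOrder P] [OrderBot P] [LocallyGeometric P] :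
    ∃ l : P → P, IsAtomLabeling l := by
  refine ⟨fun x => if h : x = ⊥ then ⊥ else (LocallyGeometric.exists_atom_le h).choose,
    fun x hx => ?_⟩
  simp only [hx, dite_false]
  exact (LocallyGeometric.exists_atom_le hx).choose_spec

section Field

variable {P : Type*} [PartialOrder P] [OrderBot P] [Fintype P] [LocallyGeometric P]

open LocallyGeometric

theorem neatDet_eq_one {R : Type*} [CommRing R] (w : P → R) {l : P → P} {k : ℕ} {x : P}
    (h : posetRank x ≠ k) : neatDet w l k (· = x) = 1 := by
  have := isEmpty_neatTuple (l := l) (k := k) (Q := (· = x)) (by rintro _ rfl; exact h)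
  exact Matrix.det_isEmpty

/-- Below `y`, only `y` itself has the rank of `y`. -/
theorem neatDet_below {R : Type*} [CommRing R] (w : P → R) (l : P → P) (y : P) :
    neatDet w l (posetRank y) (· ≤ y) = neatDet w l (posetRank y) (· = y) := by
  rw [neatDet_eq_prod, Finset.prod_eq_single y]
  · intro x hx hxy
    simp only [mem_filter, mem_univ, true_and] at hx
    exact neatDet_eq_one w (posetRank_lt (lt_of_le_of_ne hx hxy)).ne
  · simp

/-- No chain below `y` of the rank of `y` avoids `a ≤ y`. -/
theorem coneDet_rank {R : Type*} [CommRing R] (w : P → R) (l : P → P) {a y : P} (hay : a ≤ y) :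
    coneDet w l (posetRank y) y (AvoidsBelow a y) = 1 := by
  have := isEmpty_neatTuple (l := l) (k := posetRank y) (Q := AvoidsBelow a y)
    (fun x hx => (posetRank_lt_of_avoidsBelow hay hx).ne)
  exact Matrix.det_isEmpty

variable {K : Type*} [Field K]

theorem coneDet_ne_zero (w : P → K) {l : P → P} (hl : IsAtomLabeling l) {a y : P} (ha : IsAtom a)
    (hay : a ≤ y) (hy : atomWeight w y ≠ 0)
    (hD : ∀ x, x < y → neatDet w l (posetRank x) (· = x) ≠ 0) {k : ℕ} (hk : k < posetRank y) :
    coneDet w l k y (AvoidsBelow a y) ≠ 0 := by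
  cases k with
  | zero => rwa [coneDet_zero w l ⟨bot_le, fun h => ha.1 (le_bot_iff.1 h)⟩]
  | succ k =>
    have h := neatDet_mul_pow w hl ha hay k
    refine left_ne_zero_of_mul (h ▸ mul_ne_zero ?_ (pow_ne_zero _ hy))
    rw [neatDet_eq_prod]
    refine Finset.prod_ne_zero_iff.2 fun x hx => ?_
    simp only [mem_filter, mem_univ, true_and] at hx
    by_cases hr : posetRank x = k + 1
    · rw [← hr]
      refine hD x (lt_of_le_of_ne hx ?_)
      rintro rfl
      omega
    · rw [neatDet_eq_one w hr]
      exact one_ne_zero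

/-- The recursion also shows that the Gram determinants do not vanish, which allows the
multiplicative Möbius inversion below. -/
theorem neatDet_ne_zero (w : P → K) {l : P → P} (hl : IsAtomLabeling l)
    (hw : ∀ x, x ≠ ⊥ → atomWeight w x ≠ 0) (y : P) :
    neatDet w l (posetRank y) (· = y) ≠ 0 := by
  induction y using WellFoundedLT.induction with
  | ind y IH =>
  by_cases hy : y = ⊥
  · subst hy
    rw [posetRank_bot, neatDet_zero]
    exact one_ne_zero
  obtain ⟨ha, hay⟩ := hl y hy
  obtain ⟨n, hn⟩ : ∃ n, posetRank y = n + 1 := by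
    have := posetRank_lt (bot_lt_iff_ne_bot.2 hy)
    exact ⟨posetRank y - 1, by omega⟩
  have h := neatDet_mul_pow w hl ha hay n
  rw [← hn, coneDet_rank w l hay, one_mul, neatDet_below] at h
  refine left_ne_zero_of_mul (b := atomWeight w y ^ _) (ne_of_eq_of_ne h ?_)
  exact coneDet_ne_zero w hl ha hay (hw y hy) IH (by omega)

/-- The alternating product of the recursion telescopes. -/
theorem prod_neatDet_alternating (w : P → K) {l : P → P} (hl : IsAtomLabeling l) {a y : P}
    (ha : IsAtom a) (hay : a ≤ y) (n : ℕ)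
    (ht : ∀ k, k < n → coneDet w l k y (AvoidsBelow a y) ≠ 0) :
    ∏ k ∈ range (n + 1), (neatDet w l k (· ≤ y) *
        atomWeight w y ^ Fintype.card (NeatTuple l k (AvoidsBelow a y))) ^ ((-1 : ℤ) ^ k) =
      coneDet w l n y (AvoidsBelow a y) ^ ((-1 : ℤ) ^ n) := by
  induction n with
  | zero =>
    have hbot : AvoidsBelow a y ⊥ := ⟨bot_le, fun h => ha.1 (le_bot_iff.1 h)⟩
    have : Unique (NeatTuple l 0 (AvoidsBelow a y)) :=
      { default := ⟨Fin.elim0, trivial, hbot⟩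
        uniq := fun u => NeatTuple.ext (Subsingleton.elim _ _) }
    rw [Finset.prod_range_one, neatDet_zero, coneDet_zero w l hbot, Fintype.card_unique]
    simp
  | succ n ih =>
    rw [Finset.prod_range_succ, ih (fun k hk => ht k (by omega)), neatDet_mul_pow w hl ha hay n,
      mul_zpow, pow_succ, mul_neg_one, zpow_neg, zpow_neg, mul_left_comm,
      mul_inv_cancel₀ (zpow_ne_zero _ (ht n (by omega))), mul_one]

theorem prod_zpow_eq {ι : Type*} (s : Finset ι) {b : K} (hb : b ≠ 0) (f : ι → ℤ) :
    ∏ i ∈ s, b ^ f i = b ^ ∑ i ∈ s, f i := by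
  induction s using Finset.induction_on with
  | empty => simp
  | insert i s hi ih => rw [Finset.prod_insert hi, Finset.sum_insert hi, ih, zpow_add₀ hb]

/-- The alternating product of the Gram determinants below `y` is a power of the weight of `y`. -/
theorem prod_neatDet_below (w : P → K) {l : P → P} (hl : IsAtomLabeling l)
    (hw : ∀ x, x ≠ ⊥ → atomWeight w x ≠ 0) (y : P) :
    ∏ x ∈ univ.filter (fun x => x ≤ y),
        neatDet w l (posetRank x) (· = x) ^ ((-1 : ℤ) ^ posetRank x) =
      atomWeight w y ^ ((-1) ^ posetRank y * posetBeta y) := by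
  by_cases hy : y = ⊥
  · subst hy
    rw [posetBeta_bot, mul_zero, zpow_zero]
    refine Finset.prod_eq_one fun x hx => ?_
    simp only [mem_filter, mem_univ, true_and, le_bot_iff] at hx
    subst hx
    rw [posetRank_bot, neatDet_zero, one_zpow]
  obtain ⟨ha, hay⟩ := hl y hy
  have h := prod_neatDet_alternating w hl ha hay (posetRank y) fun k hk =>
    coneDet_ne_zero w hl ha hay (hw y hy) (fun x _ => neatDet_ne_zero w hl hw x) hk
  rw [coneDet_rank w l hay, one_zpow] at h
  simp only [mul_zpow, Finset.prod_mul_distrib, ← zpow_natCast, ← zpow_mul] at h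
  rw [prod_zpow_eq _ (hw y hy)] at h
  simp only [mul_comm (Nat.cast _ : ℤ)] at h
  rw [sum_card_neatTuple hl _ (fun x hx => (posetRank_lt_of_avoidsBelow hay hx).trans
    (Nat.lt_succ_self _))] at h
  rw [posetBeta_eq_neg_sum ha hay, zpow_neg, ← eq_inv_of_mul_eq_one_left h]
  simp only [neatDet_eq_prod w l _ (· ≤ y), ← Finset.prod_zpow]
  rw [Finset.prod_comm]
  refine Finset.prod_congr rfl fun x hx => ?_
  simp only [mem_filter, mem_univ, true_and] at hx
  symm
  refine Finset.prod_eq_single (posetRank x) (fun k _ hk => ?_) fun hk => ?_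
  · rw [neatDet_eq_one w hk.symm, one_zpow]
  · refine absurd (mem_range.2 ?_) hk
    rcases eq_or_lt_of_le hx with rfl | hlt
    · omega
    · have := posetRank_lt hlt
      omega

/-- Möbius inversion of `prod_neatDet_below`. -/
theorem neatDet_eq_prod_zpow (w : P → K) {l : P → P} (hl : IsAtomLabeling l)
    (hw : ∀ x, x ≠ ⊥ → atomWeight w x ≠ 0) (y : P) :
    neatDet w l (posetRank y) (· = y) =
      ∏ x ∈ univ.filter (fun x => x ≤ y), atomWeight w x ^ (posetBeta x * |posetMoebius x y|) := by
  have hinv : neatDet w l (posetRank y) (· = y) ^ ((-1 : ℤ) ^ posetRank y) =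
      ∏ x ∈ univ.filter (fun x => x ≤ y),
        (atomWeight w x ^ ((-1) ^ posetRank x * posetBeta x)) ^ posetMoebius x y := by
    simp only [← prod_neatDet_below w hl hw, ← Finset.prod_zpow]
    rw [Finset.prod_comm' (s' := fun z => univ.filter (fun x => z ≤ x ∧ x ≤ y))
      (t' := univ.filter (fun z => z ≤ y))]
    · rw [Finset.prod_eq_single y]
      · rw [Finset.prod_eq_single y]
        · rw [posetMoebius_self, zpow_one]
        · intro x hx hxy
          simp only [mem_filter, mem_univ, true_and] at hx
          exact absurd (le_antisymm hx.2 hx.1) hxy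
        · simp
      · intro z _ hzy
        rw [prod_zpow_eq _ (zpow_ne_zero _ (neatDet_ne_zero w hl hw z)), sum_posetMoebius_left hzy,
          zpow_zero]
      · simp
    · intro x z
      simp only [mem_filter, mem_univ, true_and]
      exact ⟨fun h => ⟨⟨h.2, h.1⟩, h.2.trans h.1⟩, fun h => ⟨h.1.2, h.1.1⟩⟩
  have hsq : ((-1 : ℤ) ^ posetRank y) * (-1) ^ posetRank y = 1 := by
    rw [← mul_pow]; simp
  have := congrArg (· ^ ((-1 : ℤ) ^ posetRank y)) hinv
  simp only [← zpow_mul, hsq, zpow_one, ← Finset.prod_zpow] at this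
  rw [this]
  refine Finset.prod_congr rfl fun x hx => ?_
  simp only [mem_filter, mem_univ, true_and] at hx
  rw [abs_posetMoebius hx, pow_add]
  congr 1
  ring

end Field

section Universal

variable {P : Type*} [PartialOrder P] [OrderBot P] [Fintype P]

theorem map_atomWeight {R S : Type*} [CommRing R] [CommRing S] (φ : R →+* S) (w : P → R) (x : P) :
    φ (atomWeight w x) = atomWeight (fun a => φ (w a)) x := map_sum φ _ _

theorem map_neatDet {R S : Type*} [CommRing R] [CommRing S] (φ : R →+* S) (w : P → R) (l : P → P)
    (k : ℕ) (Q : P → Prop) :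
    φ (neatDet w l k Q) = neatDet (fun a => φ (w a)) l k Q := by
  rw [neatDet, RingHom.map_det, neatDet]
  congr 1
  ext u v
  simp only [RingHom.mapMatrix_apply, Matrix.map_apply, Matrix.of_apply]
  rw [tupleGram, RingHom.map_det, tupleGram]
  congr 1
  ext i j
  exact map_sum φ _ _

variable [LocallyGeometric P]

open LocallyGeometric

/-- There are integral weights for which `y` is the only nonzero element below `y` of weight
zero. -/
theorem exists_weight_eq_zero {y : P} (hy : y ≠ ⊥) :
    ∃ p : P → ℤ, atomWeight p y = 0 ∧ ∀ x, x < y → x ≠ ⊥ → atomWeight p x ≠ 0 := by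
  obtain ⟨a, ha, hay⟩ := exists_atom_le hy
  -- All atoms have weight one, except `a`, which balances the others below `y`.
  let A : P → Finset P := fun x => univ.filter (fun b => IsAtom b ∧ b ≤ x)
  let p : P → ℤ := fun b => 1 - if b = a then ((A y).card : ℤ) else 0
  have hp : ∀ x, atomWeight p x = (A x).card - if a ≤ x then ((A y).card : ℤ) else 0 := by
    intro x
    rw [atomWeight, Finset.sum_sub_distrib, Finset.sum_ite_eq']
    simp [A, ha]
  refine ⟨p, by simp [hp, hay], fun x hxy hx => ?_⟩
  rw [hp]
  split_ifs with hax
  · have : (A x).card < (A y).card := by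
      refine Finset.card_lt_card (Finset.ssubset_iff_subset_ne.2 ⟨fun b hb => ?_, fun h => ?_⟩)
      · simp only [A, mem_filter, mem_univ, true_and] at hb ⊢
        exact ⟨hb.1, hb.2.trans hxy.le⟩
      · obtain ⟨b, hb, hby, hbx⟩ := exists_atom x y hxy
        have : b ∈ A y := by simp [A, hb, hby]
        rw [← h] at this
        exact hbx (by simpa [A, hb] using this)
    omega
  · obtain ⟨b, hb, hbx⟩ := exists_atom_le hx
    have : 0 < (A x).card := Finset.card_pos.2 ⟨b, by simp [A, hb, hbx]⟩
    omega

theorem atomWeight_X_ne_zero {x : P} (hx : x ≠ ⊥) :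
    atomWeight (fun a => (MvPolynomial.X a : MvPolynomial P ℤ)) x ≠ 0 := by
  intro h
  have := congrArg (MvPolynomial.eval fun _ => (1 : ℤ)) h
  rw [map_atomWeight, map_zero] at this
  simp only [MvPolynomial.eval_X, atomWeight, Finset.sum_const, nsmul_eq_mul, mul_one,
    Nat.cast_eq_zero, Finset.card_eq_zero] at this
  obtain ⟨a, h1, h2⟩ := exists_atom_le hx
  exact (Finset.eq_empty_iff_forall_notMem.1 this) a (by simp [h1, h2])

/-- The evaluation in the fraction field of the ring of polynomials in the atom weights. -/
theorem neatDet_universal {l : P → P} (hl : IsAtomLabeling l) (y : P) :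
    algebraMap (MvPolynomial P ℤ) (FractionRing (MvPolynomial P ℤ))
        (neatDet MvPolynomial.X l (posetRank y) (· = y)) =
      ∏ x ∈ univ.filter (fun x => x ≤ y),
        algebraMap (MvPolynomial P ℤ) (FractionRing (MvPolynomial P ℤ))
          (atomWeight MvPolynomial.X x) ^ (posetBeta x * |posetMoebius x y|) := by
  rw [map_neatDet]
  simp only [map_atomWeight]
  refine neatDet_eq_prod_zpow _ hl (fun x hx => ?_) y
  rw [← map_atomWeight]
  exact (map_ne_zero_iff _ (IsFractionRing.injective _ _)).2 (atomWeight_X_ne_zero hx)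

/-- Crapo's beta function is nonnegative: a negative value at `y` would make a power of the weight
of `y` divide a product of powers of weights of smaller elements. -/
theorem posetBeta_nonneg (y : P) : 0 ≤ posetBeta y := by
  induction y using WellFoundedLT.induction with
  | ind y IH =>
  by_cases hy : y = ⊥
  · rw [hy, posetBeta_bot]
  by_contra! hneg
  obtain ⟨l, hl⟩ := exists_isAtomLabeling P
  have h := neatDet_universal hl y
  have hmem : y ∈ univ.filter (fun x : P => x ≤ y) := by simp
  obtain ⟨n, hn⟩ : ∃ n : ℕ, posetBeta y = -((n + 1 : ℕ) : ℤ) := ⟨(-posetBeta y - 1).toNat, by omega⟩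
  have hW := (map_ne_zero_iff _ (IsFractionRing.injective (MvPolynomial P ℤ)
    (FractionRing (MvPolynomial P ℤ)))).2 (atomWeight_X_ne_zero hy)
  rw [← Finset.mul_prod_erase _ _ hmem, posetMoebius_self, abs_one, mul_one, hn, zpow_neg,
    zpow_natCast, eq_inv_mul_iff_mul_eq₀ (pow_ne_zero _ hW)] at h
  have h' : atomWeight MvPolynomial.X y ^ (n + 1) * neatDet MvPolynomial.X l (posetRank y) (· = y) =
      ∏ x ∈ (univ.filter (fun x : P => x ≤ y)).erase y,
        (atomWeight MvPolynomial.X x : MvPolynomial P ℤ) ^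
          (posetBeta x * |posetMoebius x y|).toNat := by
    refine IsFractionRing.injective (MvPolynomial P ℤ) (FractionRing (MvPolynomial P ℤ)) ?_
    rw [map_mul, map_pow, h, map_prod]
    refine Finset.prod_congr rfl fun x hx => ?_
    simp only [mem_erase, mem_filter, mem_univ, true_and] at hx
    rw [map_pow, ← zpow_natCast, Int.toNat_of_nonneg
      (mul_nonneg (IH x (lt_of_le_of_ne hx.2 hx.1)) (abs_nonneg _))]
  obtain ⟨p, hp0, hp⟩ := exists_weight_eq_zero hy
  have hev := congrArg (MvPolynomial.eval p) h'
  simp only [map_mul, map_pow, map_prod, map_atomWeight, MvPolynomial.eval_X] at hev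
  rw [hp0, zero_pow (Nat.succ_ne_zero n), zero_mul] at hev
  obtain ⟨x, hx, hx0⟩ := Finset.prod_eq_zero_iff.1 hev.symm
  simp only [mem_erase, mem_filter, mem_univ, true_and] at hx
  by_cases hxb : x = ⊥
  · subst hxb
    simp [posetBeta_bot] at hx0
  · exact hp x (lt_of_le_of_ne hx.2 hx.1) hxb (eq_zero_of_pow_eq_zero hx0)

/-- The determinant formula for the neat chains that end in `y`, over any commutative ring. -/
theorem neatDet_eq_prod_pow {R : Type*} [CommRing R] (w : P → R) {l : P → P}
    (hl : IsAtomLabeling l) (y : P) :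
    neatDet w l (posetRank y) (· = y) = ∏ x ∈ univ.filter (fun x => x ≤ y),
      atomWeight w x ^ (posetBeta x * |posetMoebius x y|).toNat := by
  have h : neatDet MvPolynomial.X l (posetRank y) (· = y) =
      ∏ x ∈ univ.filter (fun x : P => x ≤ y), (atomWeight MvPolynomial.X x : MvPolynomial P ℤ) ^
        (posetBeta x * |posetMoebius x y|).toNat := by
    refine IsFractionRing.injective (MvPolynomial P ℤ) (FractionRing (MvPolynomial P ℤ)) ?_
    rw [neatDet_universal hl, map_prod]
    refine Finset.prod_congr rfl fun x _ => ?_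
    rw [map_pow, ← zpow_natCast, Int.toNat_of_nonneg
      (mul_nonneg (posetBeta_nonneg x) (abs_nonneg _))]
  have := congrArg (MvPolynomial.eval₂Hom (Int.castRingHom R) w) h
  simpa only [map_neatDet, map_prod, map_pow, map_atomWeight, MvPolynomial.coe_eval₂Hom,
    MvPolynomial.eval₂_X] using this

end Universal

/-! ### The chain matrix -/

section Chains

variable {P : Type*} [PartialOrder P] [OrderBot P]

theorem ascend_eq {k : ℕ} {f : Fin (k + 1) → P} (hf0 : f 0 = ⊥) :
    ascend (fun i : Fin k => f i.rev.succ) = f := by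
  funext i
  induction i using Fin.cases with
  | zero => rw [ascend_zero, hf0]
  | succ i => rw [ascend_succ, Fin.rev_rev]

/-- The neat maximal chain given by a descending tuple with maximal top. -/
def NeatTuple.toChain {l : P → P} {k : ℕ} {m : P} (hm : IsMax m) (u : NeatTuple l k (· = m)) :
    NeatChain l :=
  ⟨⟨k, ascend u.tuple, fun i => (isNeat_iff_ascend.1 u.isNeat i).1⟩, ascend_zero _,
    by
      have : ascend u.tuple (Fin.last k) = m := (ascend_last _).trans u.top_prop
      show IsMax (ascend u.tuple (Fin.last k))
      rwa [this],
    fun i => (isNeat_iff_ascend.1 u.isNeat i).2⟩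

theorem NeatTuple.toChain_last {l : P → P} {k : ℕ} {m : P} (hm : IsMax m)
    (u : NeatTuple l k (· = m)) : (u.toChain hm).1.last = m :=
  (ascend_last _).trans u.top_prop

/-- For a saturated chain, generation by an atom tuple can be checked step by step. -/
theorem generates_iff [LocallyGeometric P] {k : ℕ} {f : Fin (k + 1) → P} (hf0 : f 0 = ⊥)
    (hf : ∀ i : Fin k, (f i.castSucc, f i.succ) ∈ {(a, b) : P × P | a ⋖ b}) (a : Fin k → P) :
    Generates a (⟨k, f, hf⟩ : CoverSeries P) ↔ ∀ i, IsStepAtom f i (a i) := by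
  have hcov : ∀ i : Fin k, f i.castSucc ⋖ f i.succ := hf
  have hmono : Monotone f := (Fin.strictMono_iff_lt_succ.2 fun j => (hcov j).lt).monotone
  constructor
  · rintro ⟨hat, _, hlub⟩ i
    refine ⟨hat i, (hlub i).1 ⟨i, le_refl i, rfl⟩, fun hle => ?_⟩
    -- Otherwise the join of the first `i + 1` atoms would not exceed that of the first `i`.
    refine (hcov i).lt.not_ge ((hlub i).2 ?_)
    rintro _ ⟨j, hj, rfl⟩
    have hj : j ≤ i := hj
    rcases eq_or_lt_of_le hj with rfl | hlt
    · exact hle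
    · refine ((hlub j).1 ⟨j, le_refl j, rfl⟩ : a j ≤ f j.succ).trans (hmono ?_)
      exact Fin.le_def.2 (by simpa using Fin.lt_def.1 hlt)
  · intro h
    refine ⟨fun i => (h i).1, rfl, fun i => ⟨?_, fun z hz => ?_⟩⟩
    · rintro _ ⟨j, hj, rfl⟩
      exact (h j).2.1.trans (hmono (Fin.succ_le_succ_iff.2 hj))
    · have hz' : ∀ j : Fin k, j ≤ i → a j ≤ z := fun j hj => hz ⟨j, hj, rfl⟩
      have key : ∀ m : Fin (k + 1), m ≤ i.succ → f m ≤ z := by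
        intro m
        induction m using Fin.induction with
        | zero => intro _; rw [hf0]; exact bot_le
        | succ m ih =>
          intro hm
          exact LocallyGeometric.le_of_covBy (h m).1 (h m).2.2 (hcov m) (h m).2.1
            (ih ((Fin.castSucc_lt_succ).le.trans hm)) (hz' m (Fin.succ_le_succ_iff.1 hm))
      exact key i.succ le_rfl

end Chains

section ChainMatrix

variable {P : Type*} [PartialOrder P] [OrderBot P] [Fintype P] [LocallyGeometric P]

variable {R : Type*} [CommRing R]

theorem chainMatrix_eq_tupleGram (l : P → P) (w : P → R) {k : ℕ} {f g : Fin (k + 1) → P}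
    (hf0 : f 0 = ⊥) (hg0 : g 0 = ⊥)
    (hf : ∀ i : Fin k, (f i.castSucc, f i.succ) ∈ {(a, b) : P × P | a ⋖ b})
    (hg : ∀ i : Fin k, (g i.castSucc, g i.succ) ∈ {(a, b) : P × P | a ⋖ b}) (hf' hg') :
    chainMatrix l w ⟨⟨k, f, hf⟩, hf'⟩ ⟨⟨k, g, hg⟩, hg'⟩ =
      tupleGram w (fun i => f i.succ) (fun j => g j.succ) := by
  rw [tupleGram_eq_sum_perm w hf0 (fun i => CovBy.le (hf i)) hg0 (fun i => CovBy.le (hg i))]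
  refine Finset.sum_congr rfl fun a _ => Finset.sum_congr rfl fun σ _ => ?_
  exact if_congr (and_congr (generates_iff hf0 hf a) (generates_iff hg0 hg (a ∘ σ))) rfl rfl

theorem chainMatrix_eq_zero (l : P → P) (w : P → R) (C C' : NeatChain l)
    (h : C.1.last ≠ C'.1.last) : chainMatrix l w C C' = 0 := by
  obtain ⟨⟨k, f, hf⟩, hf'⟩ := C
  obtain ⟨⟨k', g, hg⟩, hg'⟩ := C'
  by_cases hk : k' = k
  · subst hk
    rw [chainMatrix_eq_tupleGram l w hf'.1 hg'.1]
    exact tupleGram_eq_zero w hf'.1 hf hg'.1 hg h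
  · refine Finset.sum_eq_zero fun a _ => Finset.sum_eq_zero fun σ _ => if_neg ?_
    rintro ⟨-, -, h, -⟩
    exact hk h

theorem NeatTuple.toChain_bijective (l : P → P) {m : P} (hm : IsMax m) :
    Function.Bijective fun u : NeatTuple l (posetRank m) (· = m) =>
      (⟨u.toChain hm, u.toChain_last hm⟩ : {C : NeatChain l // C.1.last = m}) := by
  constructor
  · intro u v h
    have h1 : ascend u.tuple = ascend v.tuple := by
      have := congrArg (fun C : {C : NeatChain l // C.1.last = m} => C.1.1) h
      simpa [NeatTuple.toChain] using this
    refine NeatTuple.ext (funext fun i => ?_)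
    have := congrFun h1 i.rev.succ
    rwa [ascend_succ, ascend_succ, Fin.rev_rev] at this
  · rintro ⟨⟨⟨k, f, hf⟩, hf0, hmax, hneat⟩, hlast⟩
    have hf0 : f 0 = ⊥ := hf0
    have hlast : f (Fin.last k) = m := hlast
    have hu : IsNeat l (fun i : Fin k => f i.rev.succ) := by
      rw [isNeat_iff_ascend, ascend_eq hf0]
      exact fun i => ⟨hf i, hneat i⟩
    have htop : tupleTop (fun i : Fin k => f i.rev.succ) = m := by
      rw [← ascend_last, ascend_eq hf0, hlast]
    have hk : k = posetRank m := by rw [← htop, hu.posetRank_top]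
    subst hk
    refine ⟨⟨fun i => f i.rev.succ, hu, htop⟩, ?_⟩
    refine Subtype.ext (Subtype.ext ?_)
    simp only [NeatTuple.toChain, RelSeries.mk.injEq, heq_eq_eq, true_and]
    exact ascend_eq hf0

/-- The chain matrix is block diagonal, with one Gram matrix for each maximal element. -/
theorem det_chainMatrix_eq_prod_neatDet (l : P → P) (w : P → R) :
    (chainMatrix l w).det = ∏ m ∈ univ.filter (fun m : P => IsMax m),
      neatDet w l (posetRank m) (· = m) := by
  rw [det_eq_prod_fiber (chainMatrix l w) (fun C => C.1.last) (chainMatrix_eq_zero l w),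
    Finset.prod_filter]
  refine Finset.prod_congr rfl fun m _ => ?_
  split_ifs with hm
  · rw [← Matrix.det_submatrix_equiv_self
      (Equiv.ofBijective _ (NeatTuple.toChain_bijective l hm)), neatDet]
    congr 1
    ext u v
    rw [Matrix.of_apply, tupleGram_eq_ascend]
    exact chainMatrix_eq_tupleGram l w (ascend_zero _) (ascend_zero _) _ _ _ _
  · have : IsEmpty {C : NeatChain l // C.1.last = m} := ⟨fun C => hm (C.2 ▸ C.1.2.2.1)⟩
    exact Matrix.det_isEmpty

theorem cumulatedRho_nonneg (x : P) : 0 ≤ cumulatedRho x :=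
  mul_nonneg (posetBeta_nonneg x) (Finset.sum_nonneg fun _ _ => abs_nonneg _)

/-- The determinant formula for the chain matrix of a locally geometric poset, with arbitrary
weights of the atoms in a commutative ring. -/
theorem det_chainMatrix {l : P → P} (hl : IsAtomLabeling l) (w : P → R) :
    (chainMatrix l w).det = ∏ x : P, atomWeight w x ^ (cumulatedRho x).toNat := by
  rw [det_chainMatrix_eq_prod_neatDet]
  simp only [neatDet_eq_prod_pow w hl]
  rw [Finset.prod_comm' (s' := fun x => univ.filter (fun m => IsMax m ∧ x ≤ m)) (t' := univ)
    (by intro m x; simp)]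
  refine Finset.prod_congr rfl fun x _ => ?_
  rw [Finset.prod_pow_eq_pow_sum]
  congr 1
  zify
  rw [Int.toNat_of_nonneg (cumulatedRho_nonneg x), cumulatedRho, Finset.mul_sum]
  exact Finset.sum_congr rfl fun m _ => Int.toNat_of_nonneg
    (mul_nonneg (posetBeta_nonneg x) (abs_nonneg _))

end ChainMatrix

/-! ### Zero sets of complexes of oriented matroids -/

namespace COM

theorem signComp_eq_zero {E : Type*} {X Y : E → SignType} {e : E} :
    signComp X Y e = 0 ↔ X e = 0 ∧ Y e = 0 := by
  by_cases h : X e = 0 <;> simp [signComp, h]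

variable {E : Type*} [Fintype E] (M : COM E)

theorem le_iff {x y : M.ZeroSetPoset} : x ≤ y ↔ ∀ e, e ∈ x.1 → e ∈ y.1 := Iff.rfl

theorem exists_mem_of_not_le {x y : M.ZeroSetPoset} (h : ¬ y ≤ x) : ∃ e, e ∈ y.1 ∧ e ∉ x.1 := by
  simpa [M.le_iff] using h

theorem exists_covector (x : M.ZeroSetPoset) :
    ∃ X ∈ M.covectors, ∀ e, e ∈ x.1 ↔ X e = 0 := by
  obtain ⟨X, hX, h⟩ := x.2
  exact ⟨X, hX, fun e => by simp [← h, signZeroSet]⟩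

theorem exists_zeroSet {X : E → SignType} (hX : X ∈ M.covectors) :
    ∃ x : M.ZeroSetPoset, ∀ e, e ∈ x.1 ↔ X e = 0 :=
  ⟨⟨_, X, hX, rfl⟩, fun e => by simp [signZeroSet]⟩

theorem exists_inf (x y : M.ZeroSetPoset) :
    ∃ z : M.ZeroSetPoset, ∀ e, e ∈ z.1 ↔ e ∈ x.1 ∧ e ∈ y.1 := by
  obtain ⟨X, hX, hx⟩ := M.exists_covector x
  obtain ⟨Y, hY, hy⟩ := M.exists_covector y
  obtain ⟨z, hz⟩ := M.exists_zeroSet (M.comp_mem hX hY)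
  exact ⟨z, fun e => by rw [hz, hx, hy, signComp_eq_zero]⟩

theorem mem_bot_iff {e : E} : e ∈ (⊥ : M.ZeroSetPoset).1 ↔ M.IsLoop e := by
  constructor
  · intro h X hX
    obtain ⟨x, hx⟩ := M.exists_zeroSet hX
    exact (hx e).1 (M.le_iff.1 bot_le e h)
  · intro h
    obtain ⟨X, hX, hb⟩ := M.exists_covector ⊥
    exact (hb e).2 (h X hX)

/-- The exchange property of zero sets below a common zero set `y`: if `u` contains `x` and `f` but
not `e`, then some zero set contains `x` and `e` but not `f`. It is strong elimination of `e` from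
covectors that agree with those of `x` and `u` up to sign on `y`. -/
theorem exists_exchange {x u y : M.ZeroSetPoset} (hxu : x ≤ u) (huy : u ≤ y) {e f : E}
    (heu : e ∉ u.1) (hey : e ∈ y.1) (hfx : f ∉ x.1) (hfu : f ∈ u.1) :
    ∃ v : M.ZeroSetPoset, x ≤ v ∧ v ≤ y ∧ e ∈ v.1 ∧ f ∉ v.1 := by
  have hex : e ∉ x.1 := fun h => heu (hxu h)
  have hfy : f ∈ y.1 := huy hfu
  obtain ⟨X, hX, hx⟩ := M.exists_covector x
  obtain ⟨U, hU, hu⟩ := M.exists_covector u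
  obtain ⟨Y, hY, hy⟩ := M.exists_covector y
  simp only [M.le_iff, hx, hu, hy] at *
  obtain ⟨B, hB, hBe, hB0, hBY⟩ : ∃ B ∈ M.covectors, B e = -X e ∧
      (∀ g, Y g = 0 → U g = 0 → B g = 0) ∧ ∀ g, Y g ≠ 0 → B g = Y g := by
    have hsign : ∀ s t : SignType, s ≠ 0 → t ≠ 0 → t = -s ∨ -t = -s := by decide
    rcases hsign (X e) (U e) hex heu with h | h
    · exact ⟨_, M.comp_mem hY hU, by simpa [signComp, hey] using h,
        fun g h1 h2 => by simp [signComp, h1, h2], fun g h1 => by simp [signComp, h1]⟩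
    · exact ⟨_, M.face_symm Y hY U hU, by simpa [signComp, hey] using h,
        fun g h1 h2 => by simp [signComp, h1, h2], fun g h1 => by simp [signComp, h1]⟩
  have hA : ∀ g, Y g = 0 → signComp Y X g = X g := fun g h => by simp [signComp, h]
  have hAY : ∀ g, Y g ≠ 0 → signComp Y X g = Y g := fun g h => by simp [signComp, h]
  obtain ⟨V, hV, hVe, hVf⟩ := M.strong_elim _ (M.comp_mem hY hX) B hB e
    ⟨by rw [hA e hey, hBe, neg_neg], by rwa [hA e hey]⟩
  obtain ⟨v, hv⟩ := M.exists_zeroSet hV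
  refine ⟨v, fun g hg => ?_, fun g hg => ?_, (hv e).2 hVe, fun hfv => ?_⟩
  · have hYg := huy g (hxu g hg)
    rw [hv, hVf g (fun h => h.2 (by rw [hA g hYg, hg])), signComp_eq_zero, hA g hYg]
    exact ⟨hg, hB0 g hYg (hxu g hg)⟩
  · by_contra hYg
    have hsep : g ∉ signSeparator (signComp Y X) B := by
      rintro ⟨h, -⟩
      have hs : ∀ s : SignType, s = -s → s = 0 := by decide
      rw [hAY g hYg, hBY g hYg] at h
      exact hYg (hs _ h)
    rw [hv, hVf g hsep, signComp_eq_zero, hAY g hYg] at hg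
    exact hYg hg.1
  · have hsep : f ∉ signSeparator (signComp Y X) B := by
      rintro ⟨h, -⟩
      rw [hA f hfy, hB0 f hfy hfu, neg_zero] at h
      exact hfx h
    rw [hv, hVf f hsep, signComp_eq_zero, hA f hfy] at hfv
    exact hfx hfv.1

theorem le_of_mem_atom {a x : M.ZeroSetPoset} (ha : IsAtom a) {e : E} (hea : e ∈ a.1)
    (heb : e ∉ (⊥ : M.ZeroSetPoset).1) (hex : e ∈ x.1) : a ≤ x := by
  obtain ⟨z, hz⟩ := M.exists_inf a x
  have hza : z ≤ a := M.le_iff.2 fun g hg => ((hz g).1 hg).1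
  have hzx : z ≤ x := M.le_iff.2 fun g hg => ((hz g).1 hg).2
  rcases ha.le_iff.1 hza with h | h
  · exact absurd (h ▸ (hz e).2 ⟨hea, hex⟩) heb
  · exact h ▸ hzx

/-- Every element of the ground set that is not a loop lies in an atom below any zero set that
contains it. -/
theorem exists_atom_mem {y : M.ZeroSetPoset} {e : E} (hey : e ∈ y.1)
    (heb : e ∉ (⊥ : M.ZeroSetPoset).1) : ∃ a : M.ZeroSetPoset, IsAtom a ∧ a ≤ y ∧ e ∈ a.1 := by
  obtain ⟨a, ⟨hay, hea⟩, hmin⟩ :=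
    (Set.toFinite {z : M.ZeroSetPoset | z ≤ y ∧ e ∈ z.1}).exists_minimal
      ⟨y, le_rfl, hey⟩
  refine ⟨a, ⟨fun h => heb (h ▸ hea), fun u hua => ?_⟩, hay, hea⟩
  by_contra hu
  obtain ⟨f, hfu, hfb⟩ := M.exists_mem_of_not_le (fun h : u ≤ ⊥ => hu (le_bot_iff.1 h))
  have heu : e ∉ u.1 := fun h => hua.not_ge (hmin ⟨hua.le.trans hay, h⟩ hua.le)
  obtain ⟨v, -, hvy, hev, hfv⟩ := M.exists_exchange bot_le (hua.le.trans hay) heu hey hfb hfu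
  obtain ⟨z, hz⟩ := M.exists_inf a v
  have hza : z ≤ a := M.le_iff.2 fun g hg => ((hz g).1 hg).1
  have haz : a ≤ z := hmin ⟨hza.trans hay, (hz e).2 ⟨hea, hev⟩⟩ hza
  exact hfv ((hz f).1 (haz (hua.le hfu))).2

/-- The poset of zero sets is locally geometric. -/
instance : LocallyGeometric M.ZeroSetPoset where
  exists_meet x y := by
    obtain ⟨z, hz⟩ := M.exists_inf x y
    exact ⟨z, M.le_iff.2 fun g hg => ((hz g).1 hg).1, M.le_iff.2 fun g hg => ((hz g).1 hg).2,
      fun t h1 h2 => M.le_iff.2 fun g hg => (hz g).2 ⟨h1 hg, h2 hg⟩⟩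
  exists_cover x a y ha hax hxy hay := by
    obtain ⟨s, ⟨hxs, has⟩, hmin⟩ :=
      (Set.toFinite {z : M.ZeroSetPoset | x ≤ z ∧ a ≤ z}).exists_minimal ⟨y, hxy, hay⟩
    have hle : ∀ t, x ≤ t → a ≤ t → s ≤ t := by
      intro t hxt hat
      obtain ⟨z, hz⟩ := M.exists_inf s t
      have hzs : z ≤ s := M.le_iff.2 fun g hg => ((hz g).1 hg).1
      have hzt : z ≤ t := M.le_iff.2 fun g hg => ((hz g).1 hg).2
      refine (hmin ⟨M.le_iff.2 fun g hg => (hz g).2 ⟨hxs hg, hxt hg⟩,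
        M.le_iff.2 fun g hg => (hz g).2 ⟨has hg, hat hg⟩⟩ hzs).trans hzt
    refine ⟨s, ⟨lt_of_le_of_ne hxs fun h => hax (h ▸ has), fun u hxu hus => ?_⟩, has, hle⟩
    obtain ⟨e, hea, heb⟩ := M.exists_mem_of_not_le (fun h : a ≤ ⊥ => ha.1 (le_bot_iff.1 h))
    obtain ⟨f, hfu, hfx⟩ := M.exists_mem_of_not_le hxu.not_ge
    have heu : e ∉ u.1 := fun h => hus.not_ge (hle u hxu.le (M.le_of_mem_atom ha hea heb h))
    obtain ⟨v, hxv, -, hev, hfv⟩ := M.exists_exchange hxu.le hus.le heu (has hea) hfx hfu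
    exact hfv (hle v hxv (M.le_of_mem_atom ha hea heb hev) (hus.le hfu))
  exists_atom x y hxy := by
    obtain ⟨e, hey, hex⟩ := M.exists_mem_of_not_le hxy.not_ge
    obtain ⟨a, ha, hay, hea⟩ :=
      M.exists_atom_mem hey (fun h => hex (M.le_iff.1 (bot_le (a := x)) e h))
    exact ⟨a, ha, hay, fun h => hex (h hea)⟩

/-- The atoms below a zero set partition its elements that are not loops, so weights are additive
over atoms. -/
theorem weight_eq_atomWeight (x : M.ZeroSetPoset) : M.weight x = atomWeight M.weight x := by
  unfold atomWeight weight
  rw [← Finset.sum_biUnion]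
  · refine Finset.sum_congr ?_ fun _ _ => rfl
    ext e
    simp only [mem_filter, mem_biUnion, mem_univ, true_and]
    constructor
    · rintro ⟨hex, he⟩
      obtain ⟨a, ha, hax, hea⟩ := M.exists_atom_mem hex (mt M.mem_bot_iff.1 he)
      exact ⟨a, ⟨ha, hax⟩, hea, he⟩
    · rintro ⟨a, ⟨-, hax⟩, hea, he⟩
      exact ⟨hax hea, he⟩
  · intro a ha b hb hab
    simp only [coe_filter, mem_univ, true_and, Set.mem_ofPred_eq] at ha hb
    refine Finset.disjoint_left.2 fun e hea heb => hab ?_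
    simp only [mem_filter] at hea heb
    have he := mt M.mem_bot_iff.1 hea.2
    exact le_antisymm (M.le_of_mem_atom ha.1 hea.1 he heb.1) (M.le_of_mem_atom hb.1 heb.1 he hea.1)

end COM

end LocallyGeometric

/-- For every labeling of the poset `Z` of zero sets of a COM, the exponents `ρ(x)` are nonnegative
and the determinant of the chain matrix of `Z` is `± ∏_{x ∈ Z} w(x)^{ρ(x)}`. -/
theorem mainTheorem3 {E : Type*} [Fintype E] (M : COM E)
    (l : M.ZeroSetPoset → M.ZeroSetPoset) (hl : IsAtomLabeling l) :
    (∀ x : M.ZeroSetPoset, 0 ≤ cumulatedRho x) ∧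
      ((chainMatrix l M.weight).det =
          ∏ x : M.ZeroSetPoset, M.weight x ^ (cumulatedRho x).toNat ∨
        (chainMatrix l M.weight).det =
          -∏ x : M.ZeroSetPoset, M.weight x ^ (cumulatedRho x).toNat) := by
  refine ⟨cumulatedRho_nonneg, Or.inl ?_⟩
  rw [det_chainMatrix hl]
  exact Finset.prod_congr rfl fun x _ => by rw [M.weight_eq_atomWeight x]
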